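/- Let $p$ be a prime, let $D$ be a division algebra of characteristic $p$ that is finite-dimensional over its center $C$, of degree $d$ (that is, $[D:C]=d^2$), and let $\delta:D\to D$ be a derivation, i.e. an additive map with $\delta(ab)=a\delta(b)+\delta(a)b$. Put $F=\{c\in C : \delta(c)=0\}$ and suppose that $\delta|_C$, viewed as an $F$-linear endomorphism of $C$, is algebraic over $F$ with minimal polynomial $$g(t)=t^{p^e}+c_1t^{p^{e-1}}+\dots+c_e t\in F[t].$$ Let $d_0\in D$ be such that $g(\delta)(a)=d_0a-ad_0$ for all $a\in D$ and $\delta(d_0)=0$. Let $R=D[t;\delta]$ be the differential polynomial ring, with coefficients written on the left and $ta=at+\delta(a)$ for $a\in D$, and put $x=g(t)-d_0\in R$. Let $D(t;\delta)=\{f/z : f\in R,\ 0\neq z\in C(R)\}$ be the ring of central quotients of $R$, where $C(R)$ is the center of $R$, and let $N$ be the reduced norm of $D(t;\delta)$ over the field of fractions of $C(R)$. Let $E\subseteq D$ be a subfield containing $C$ with $[E:C]=d$, and let $\omega:D\to M_d(E)$ be the left regular representation with respect to any basis $v_1,\dots,v_d$ of $D$ as a left $E$-vector space: $v_i a=\sum_j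 \omega(a)_{ij}v_j$. Theorem. For every $f=a_0+a_1t+\dots+a_mt^m\in R$ with $a_m\neq 0$, the reduced norm $N(f)$ lies in $F[x]$, has degree $dm$ as a polynomial in $x$, and its leading coefficient is $\pm\det(\omega(a_m))^{p^e}$: $$N(f)=\pm\det(\omega(a_m))^{p^e}x^{dm}+(\text{terms of lower degree in }x).$$ -/

import Mathlib

open Polynomial
open scoped IsMulCommutative TensorProduct

universe u v

noncomputable section

/-! ### Derivations of a (noncommutative) ring -/

/-- A derivation of a ring `D`: an additive map with `δ (a b) = a δ(b) + δ(a) b`. -/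
structure RingDerivation (D : Type u) [Ring D] extends D →+ D where
  leibniz' : ∀ a b : D, toFun (a * b) = a * toFun b + toFun a * b

namespace RingDerivation

instance {D : Type u} [Ring D] : CoeFun (RingDerivation D) (fun _ => D → D) :=
  ⟨fun δ => δ.toAddMonoidHom⟩

section Ring

variable {D : Type u} [Ring D] (δ : RingDerivation D)

theorem leibniz (a b : D) : δ (a * b) = a * δ b + δ a * b := δ.leibniz' a b

theorem map_one : δ 1 = 0 := by
  have h := δ.leibniz 1 1
  simpa using h

theorem map_mem_center {c : D} (hc : c ∈ Subring.center D) : δ c ∈ Subring.center D := by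
  rw [Subring.mem_center_iff] at hc ⊢
  intro a
  have h := congrArg (fun y => δ y) (hc a)
  simp only [δ.leibniz, ← hc (δ a)] at h
  rw [add_comm (δ a * c)] at h
  exact add_right_cancel h

end Ring

section DivisionRing

variable {D : Type u} [DivisionRing D] (δ : RingDerivation D)

/-- The field `F = Const(δ) ∩ C`, as a subfield of the center `C` of `D`. -/
def centralConst : Subfield (Subring.center D) where
  carrier := {c | δ (c : D) = 0}
  mul_mem' := by
    intro a b ha hb
    simp only [Set.mem_ofPred_eq] at ha hb ⊢
    simp [δ.leibniz, ha, hb]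
  one_mem' := δ.map_one
  add_mem' := by
    intro a b ha hb
    simp only [Set.mem_ofPred_eq] at ha hb ⊢
    simp [ha, hb]
  zero_mem' := by simp
  neg_mem' := by
    intro a ha
    simp only [Set.mem_ofPred_eq] at ha ⊢
    simp [ha]
  inv_mem' := by
    intro a ha
    simp only [Set.mem_ofPred_eq, Subring.center.coe_inv] at ha ⊢
    rcases eq_or_ne a 0 with rfl | h0
    · simp
    · have h0' : (a : D) ≠ 0 := by simpa using h0
      have h := δ.leibniz (a : D) (a : D)⁻¹
      rw [mul_inv_cancel₀ h0', δ.map_one, ha, zero_mul, add_zero] at h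
      exact (mul_eq_zero.mp h.symm).resolve_left h0'

/-- `δ` as an `F`-linear endomorphism of `D`. -/
def toEnd : Module.End δ.centralConst D where
  toFun := δ
  map_add' := by simp
  map_smul' := by
    intro c a
    have hc : δ ((c : Subring.center D) : D) = 0 := c.2
    change δ (((c : Subring.center D) : D) * a) = ((c : Subring.center D) : D) * δ a
    rw [δ.leibniz, hc, zero_mul, add_zero]

/-- The restriction `δ|_C` of `δ` to the center `C` of `D`, as an `F`-linear endomorphism. -/
def centerEnd : Module.End δ.centralConst (Subring.center D) where
  toFun c := ⟨δ (c : D), δ.map_mem_center c.2⟩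
  map_add' := by
    intro a b
    ext
    simp
  map_smul' := by
    intro c a
    ext
    exact δ.toEnd.map_smul c (a : D)

end DivisionRing

end RingDerivation

/-! ### The differential polynomial ring `D[t;δ]` -/

/-- The ring `D[t;δ]` of differential polynomials `a₀ + a₁ t + ⋯ + aₘ tᵐ` (coefficients on the
left). The underlying additive group is that of the polynomials over `D`; the
multiplication, defined below, is determined by `t a = a t + δ(a)`. -/
def DiffPoly {D : Type u} [Ring D] (_ : RingDerivation D) : Type u := D[X]

namespace DiffPoly

section Ring

variable {D : Type u} [Ring D] (δ : RingDerivation D)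

/-- Coefficientwise application of `δ`. -/
def coeffDer : D[X] →+ D[X] where
  toFun g := g.sum fun i b => monomial i (δ b)
  map_zero' := by simp
  map_add' g h := by
    rw [Polynomial.sum_add_index]
    · simp
    · simp

/-- Left multiplication by `t`: `t · Σ bⱼ tʲ = Σ (bⱼ tʲ⁺¹ + δ(bⱼ) tʲ)`. -/
def tMul : AddMonoid.End D[X] := AddMonoidHom.mulLeft (X : D[X]) + coeffDer δ

/-- Left multiplication by `Σ aᵢ tⁱ`: the operator `Σ aᵢ · (left multiplication by t)ⁱ`. -/
def leftMul (f : D[X]) : AddMonoid.End D[X] :=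
  f.eval₂ (Module.toAddMonoidEnd D D[X]) (tMul δ)

theorem coeffDer_monomial (n : ℕ) (b : D) : coeffDer δ (monomial n b) = monomial n (δ b) := by
  change (monomial n b).sum (fun i b => monomial i (δ b)) = _
  rw [Polynomial.sum_monomial_index]
  simp

theorem coeff_coeffDer (g : D[X]) (n : ℕ) : (coeffDer δ g).coeff n = δ (g.coeff n) := by
  induction g using Polynomial.induction_on' with
  | add p q hp hq => simp [hp, hq]
  | monomial k b =>
    rw [coeffDer_monomial, coeff_monomial, coeff_monomial]
    split_ifs <;> simp

theorem tMul_apply (g : D[X]) : tMul δ g = X * g + coeffDer δ g := rfl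

theorem tMul_monomial (n : ℕ) (b : D) :
    tMul δ (monomial n b) = monomial (n + 1) b + monomial n (δ b) := by
  rw [tMul_apply, coeffDer_monomial, X_mul_monomial]

theorem leftMul_add (f g : D[X]) : leftMul δ (f + g) = leftMul δ f + leftMul δ g :=
  eval₂_add _ _

theorem leftMul_monomial (n : ℕ) (b : D) :
    leftMul δ (monomial n b) = Module.toAddMonoidEnd D D[X] b * tMul δ ^ n :=
  eval₂_monomial _ _

theorem tMul_comm (b : D) : tMul δ * Module.toAddMonoidEnd D D[X] b =
    Module.toAddMonoidEnd D D[X] b * tMul δ + Module.toAddMonoidEnd D D[X] (δ b) := by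
  ext g : 1
  change X * (b • g) + coeffDer δ (b • g) = b • (X * g + coeffDer δ g) + δ b • g
  ext n
  rw [← C_mul', ← C_mul', ← C_mul', ← mul_assoc, X_mul_C]
  simp only [coeff_add, coeff_C_mul, coeff_coeffDer, δ.leibniz, mul_add, mul_assoc, add_assoc]

theorem leftMul_tMul (g : D[X]) : leftMul δ (tMul δ g) = tMul δ * leftMul δ g := by
  induction g using Polynomial.induction_on' with
  | add p q hp hq => rw [map_add, leftMul_add, leftMul_add, hp, hq, mul_add]
  | monomial k b =>
    rw [tMul_monomial, leftMul_add, leftMul_monomial, leftMul_monomial, leftMul_monomial,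
      ← mul_assoc, tMul_comm, add_mul, mul_assoc, ← pow_succ']

theorem leftMul_smul (a : D) (g : D[X]) :
    leftMul δ (a • g) = Module.toAddMonoidEnd D D[X] a * leftMul δ g := by
  induction g using Polynomial.induction_on' with
  | add p q hp hq => rw [smul_add, leftMul_add, leftMul_add, hp, hq, mul_add]
  | monomial k b =>
    rw [smul_monomial, leftMul_monomial, leftMul_monomial, smul_eq_mul, _root_.map_mul, mul_assoc]

theorem leftMul_leftMul (f g : D[X]) : leftMul δ (leftMul δ f g) = leftMul δ f * leftMul δ g := by
  induction f using Polynomial.induction_on' with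
  | add p q hp hq =>
    rw [leftMul_add]
    change leftMul δ (leftMul δ p g + leftMul δ q g) = _
    rw [leftMul_add, hp, hq, add_mul]
  | monomial k b =>
    rw [leftMul_monomial]
    change leftMul δ (b • (tMul δ ^ k) g) = _
    rw [leftMul_smul, mul_assoc]
    congr 1
    induction k generalizing g with
    | zero => simp
    | succ k ih =>
      rw [pow_succ]
      change leftMul δ ((tMul δ ^ k) (tMul δ g)) = _
      rw [ih, leftMul_tMul, mul_assoc]

theorem tMul_pow_one (n : ℕ) : (tMul δ ^ n) 1 = monomial n 1 := by
  induction n with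
  | zero => rfl
  | succ n ih =>
    rw [pow_succ']
    change tMul δ ((tMul δ ^ n) 1) = _
    rw [ih, tMul_monomial, δ.map_one, map_zero, add_zero]

theorem leftMul_one_right (f : D[X]) : leftMul δ f 1 = f := by
  induction f using Polynomial.induction_on' with
  | add p q hp hq =>
    rw [leftMul_add]
    change leftMul δ p 1 + leftMul δ q 1 = _
    rw [hp, hq]
  | monomial k b =>
    rw [leftMul_monomial]
    change b • (tMul δ ^ k) 1 = _
    rw [tMul_pow_one, smul_monomial, smul_eq_mul, mul_one]

instance : AddCommGroup (DiffPoly δ) := inferInstanceAs (AddCommGroup D[X])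

/-- The coefficient list of a differential polynomial, as an ordinary polynomial. -/
def toPoly : DiffPoly δ ≃+ D[X] := AddEquiv.refl D[X]

instance : Ring (DiffPoly δ) :=
  { (inferInstance : AddCommGroup (DiffPoly δ)) with
    mul := fun f g => (toPoly δ).symm (leftMul δ (toPoly δ f) (toPoly δ g))
    one := (toPoly δ).symm 1
    mul_assoc := fun f g h =>
      DFunLike.congr_fun (leftMul_leftMul δ (toPoly δ f) (toPoly δ g)) (toPoly δ h)
    one_mul := fun f =>
      DFunLike.congr_fun (eval₂_one (Module.toAddMonoidEnd D D[X]) (tMul δ)) (toPoly δ f)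
    mul_one := fun f => leftMul_one_right δ (toPoly δ f)
    left_distrib := fun f g h => map_add (leftMul δ (toPoly δ f)) (toPoly δ g) (toPoly δ h)
    right_distrib := fun f g h =>
      DFunLike.congr_fun (leftMul_add δ (toPoly δ f) (toPoly δ g)) (toPoly δ h)
    zero_mul := fun f =>
      DFunLike.congr_fun (eval₂_zero (Module.toAddMonoidEnd D D[X]) (tMul δ)) (toPoly δ f)
    mul_zero := fun f => map_zero (leftMul δ (toPoly δ f)) }

theorem toPoly_mul (f g : DiffPoly δ) : toPoly δ (f * g) = leftMul δ (toPoly δ f) (toPoly δ g) := rfl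

/-- The embedding of `D` into `D[t;δ]` as constant polynomials. -/
def const : D →+* DiffPoly δ where
  toFun a := (toPoly δ).symm (C a)
  map_one' := rfl
  map_mul' a b := by
    apply (toPoly δ).injective
    rw [toPoly_mul]
    simp only [AddEquiv.apply_symm_apply]
    rw [← monomial_zero_left, ← monomial_zero_left, ← monomial_zero_left, leftMul_monomial,
      pow_zero, mul_one]
    exact (smul_monomial a 0 b).symm
  map_zero' := map_zero (C : D →+* D[X])
  map_add' := map_add (C : D →+* D[X])

/-- The indeterminate `t` of `D[t;δ]`. -/
def t : DiffPoly δ := (toPoly δ).symm X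

theorem t_mul_const (a : D) : t δ * const δ a = const δ a * t δ + const δ (δ a) := by
  apply (toPoly δ).injective
  change leftMul δ X (C a) = leftMul δ (C a) X + C (δ a)
  rw [← monomial_one_one_eq_X, ← monomial_zero_left, ← monomial_zero_left, leftMul_monomial,
    leftMul_monomial, pow_one, pow_zero, _root_.map_one, one_mul, mul_one, tMul_monomial]
  congr 1
  change _ = a • monomial 1 1
  rw [smul_monomial, smul_eq_mul, mul_one]

theorem const_mul_t_pow (a : D) (n : ℕ) : const δ a * t δ ^ n = (toPoly δ).symm (monomial n a) := by
  have h : t δ ^ n = (toPoly δ).symm (monomial n 1) := by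
    induction n with
    | zero => rfl
    | succ n ih =>
      rw [pow_succ', ih]
      apply (toPoly δ).injective
      change leftMul δ X (monomial n 1) = monomial (n + 1) 1
      rw [← monomial_one_one_eq_X, leftMul_monomial, pow_one, _root_.map_one, one_mul,
        tMul_monomial, δ.map_one, map_zero, add_zero]
  rw [h]
  apply (toPoly δ).injective
  change leftMul δ (C a) (monomial n 1) = monomial n a
  rw [← monomial_zero_left, leftMul_monomial, pow_zero, mul_one]
  change a • monomial n 1 = _
  rw [smul_monomial, smul_eq_mul, mul_one]

theorem coeff_tMul_pow_of_lt (g : D[X]) (i k : ℕ) (h : g.natDegree + i < k) :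
    ((tMul δ ^ i) g).coeff k = 0 := by
  induction i generalizing k with
  | zero => exact coeff_eq_zero_of_natDegree_lt h
  | succ i ih =>
    obtain ⟨k, rfl⟩ : ∃ l, k = l + 1 := ⟨k - 1, by omega⟩
    rw [pow_succ']
    change (X * (tMul δ ^ i) g + coeffDer δ ((tMul δ ^ i) g)).coeff (k + 1) = 0
    rw [coeff_add, coeff_X_mul, coeff_coeffDer, ih k (by omega), ih (k + 1) (by omega)]
    simp

theorem coeff_tMul_pow (g : D[X]) (i : ℕ) :
    ((tMul δ ^ i) g).coeff (g.natDegree + i) = g.leadingCoeff := by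
  induction i with
  | zero => rfl
  | succ i ih =>
    rw [pow_succ', ← add_assoc]
    change (X * (tMul δ ^ i) g + coeffDer δ ((tMul δ ^ i) g)).coeff (g.natDegree + i + 1) = _
    rw [coeff_add, coeff_X_mul, coeff_coeffDer, ih,
      coeff_tMul_pow_of_lt δ g i _ (Nat.lt_succ_self _)]
    simp

theorem coeff_leftMul (f g : D[X]) :
    (leftMul δ f g).coeff (g.natDegree + f.natDegree) = f.leadingCoeff * g.leadingCoeff := by
  have h : leftMul δ f g = ∑ i ∈ Finset.range (f.natDegree + 1), f.coeff i • (tMul δ ^ i) g := by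
    rw [leftMul, eval₂_eq_sum_range]
    exact AddMonoidHom.finsetSum_apply _ _ _
  rw [h, finsetSum_coeff, Finset.sum_eq_single f.natDegree]
  · rw [coeff_smul, coeff_tMul_pow, smul_eq_mul]
    rfl
  · intro i hi hne
    have hi' := Finset.mem_range.mp hi
    rw [coeff_smul, coeff_tMul_pow_of_lt δ g i _ (by omega), smul_zero]
  · intro h'
    exact absurd (Finset.mem_range.mpr (Nat.lt_succ_self _)) h'

end Ring

section Domain

variable {D : Type u} [DivisionRing D] (δ : RingDerivation D)

instance : Nontrivial (DiffPoly δ) := inferInstanceAs (Nontrivial D[X])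

instance : IsDomain (DiffPoly δ) :=
  have : NoZeroDivisors (DiffPoly δ) :=
    ⟨by
      intro f g h
      have h1 := coeff_leftMul δ (toPoly δ f) (toPoly δ g)
      have h2 : leftMul δ (toPoly δ f) (toPoly δ g) = 0 := h
      rw [h2, coeff_zero] at h1
      rcases mul_eq_zero.mp h1.symm with h3 | h3
      · exact Or.inl (leadingCoeff_eq_zero.mp h3)
      · exact Or.inr (leadingCoeff_eq_zero.mp h3)⟩
  NoZeroDivisors.to_isDomain _

/-- Evaluation of a polynomial with coefficients in `F` at an element `y` of `D[t;δ]`: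
`Σ cᵢ Xⁱ ↦ Σ cᵢ yⁱ`. -/
def evalAt (y : DiffPoly δ) (P : δ.centralConst[X]) : DiffPoly δ :=
  P.eval₂ ((const δ).comp (algebraMap δ.centralConst D)) y

/-- The element `x = g(t) - d₀` of `D[t;δ]`. -/
def centralVar (g : δ.centralConst[X]) (d₀ : D) : DiffPoly δ := evalAt δ (t δ) g - const δ d₀

end Domain

end DiffPoly

/-! ### Rings of central quotients -/

/-- The ring of central quotients `{f / z | f ∈ R, z ∈ C(R) a non-zero-divisor}` of a ring `R`. -/
def CentralQuotients (R : Type u) [Ring R] : Type u :=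
  LocalizedModule (nonZeroDivisors (Subring.center R)) R

namespace CentralQuotients

variable (R : Type u) [Ring R]

instance : Ring (CentralQuotients R) :=
  inferInstanceAs (Ring (LocalizedModule (nonZeroDivisors (Subring.center R)) R))

instance : Algebra (FractionRing (Subring.center R)) (CentralQuotients R) :=
  LocalizedModule.algebraOfIsLocalization (R := Subring.center R)
    (S := nonZeroDivisors (Subring.center R)) (FractionRing (Subring.center R)) (A := R)

/-- The canonical map `f ↦ f / 1`. -/
def of : R →+* CentralQuotients R :=
  LocalizedModule.numeratorRingHom (R := Subring.center R)
    (S := nonZeroDivisors (Subring.center R)) (A := R)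

end CentralQuotients

/-! ### The reduced norm -/

open Classical in
/-- The reduced norm of a finite-dimensional central simple algebra `A` over a field `K`:
with `L` an algebraic closure of `K` and `φ : L ⊗ A ≃ M_n(L)` an isomorphism of `L`-algebras, the
reduced norm of `a` is the element of `K` whose image in `L` is `det (φ (1 ⊗ a))`
(junk value `0` if there is no such element, which does not happen when `A` is central simple). -/
def reducedNorm (K : Type u) (A : Type v) [Field K] [Ring A] [Algebra K A] (a : A) : K :=
  if h : ∃ (b : K) (n : ℕ) (φ : (AlgebraicClosure K ⊗[K] A) ≃ₐ[AlgebraicClosure K]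
      Matrix (Fin n) (Fin n) (AlgebraicClosure K)),
      algebraMap K (AlgebraicClosure K) b = (φ (1 ⊗ₜ[K] a)).det
  then h.choose else 0

/-! ### The left regular representation of `D` over a subfield -/

/-- The left regular representation `ω : D → M_d(E)` of `D`, regarded as a left vector space with
basis `v₁, …, v_d` over the commutative subalgebra `E`: `vᵢ a = Σⱼ ω(a)ᵢⱼ vⱼ`. -/
def leftRegularRep {D : Type u} [DivisionRing D] {E : Subalgebra (Subring.center D) D}
    [IsMulCommutative E] {d : ℕ} (v : Module.Basis (Fin d) E D) :
    D →+* Matrix (Fin d) (Fin d) E where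
  toFun a := Matrix.of fun i j => v.repr (v i * a) j
  map_one' := by
    ext i j : 2
    simp [Matrix.one_apply, Finsupp.single_apply]
  map_zero' := by
    ext i j : 2
    simp
  map_add' a b := by
    ext i j : 2
    simp [mul_add]
  map_mul' a b := by
    ext i j : 2
    simp only [Matrix.of_apply, Matrix.mul_apply]
    conv_lhs => rw [← mul_assoc, ← v.sum_repr (v i * a), Finset.sum_mul]
    simp only [smul_mul_assoc, map_sum, map_smul, Finsupp.coe_finsetSum, Finset.sum_apply,
      Finsupp.coe_smul, Pi.smul_apply, smul_eq_mul]

end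

/-! Write `N` for `p ^ e`, `K` for the fraction field of the center of `R` and `A` for `D(t;δ)`. The
idea is to compute the reduced norm as the determinant of right multiplication over a
self-centralizing commutative subring of `A`, and to read off its leading coefficient from a
weighted degree.

Since `g` is a `p`-polynomial, `x` is central in `R`. It is monic of degree `N` in `t`, so `R` is a
free left `D[x]`-module on `1, t, …, t^(N-1)` (`exists_expansion`, `expansion_unique`). The maps `1,
δ, …, δ^(N-1)` on `C` are left independent over `D` because `g` is the minimal polynomial
(`eq_zero_of_forall_sum_iterate_eq_zero`), and `E` is its own centralizer in `D` by a dimension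
count (`mem_of_forall_commute`). Hence the centralizer of `E` in `R` is `E[x]`
(`exists_eq_evalCenter_of_commute`), and in `A` it is a commutative localization `S` of `E[x]`, over
which the `d * N` elements `v_k t^r` form a basis of `A`.

Every nonzero element of `R` has a nonzero central left multiple (`exists_mul_mem_center`), so `A`
is a division ring with center `K`. Its regular representation over `S` becomes a splitting over the
algebraic closure of `K`, so the reduced norm of `f` is the determinant of right multiplication by
`f` on the `v_k t^r` (`det_regMatrix_eq_reducedNorm`).

That matrix has entries in `E[x]`. Give `x^q t^r` the weight `N q + r`: the part of top weight is
`ω(a_m)` tensored with the cyclic shift by `m` modulo `N`, whose determinant is `±det(ω(a_m))^N`,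
and counting weights gives degree `d m` (`det_coeff_of_weighted`). Finally, the reduced norm is
central, and a central element of `E[x]` has coefficients in `F`
(`exists_map_eq_of_evalCenter_mem_center`). -/

/-! ### Central division algebras and their splitting representations -/

section TensorProduct

variable {K B A Ω T : Type*} [Field K] [Ring B] [Algebra K B] [Ring A] [Algebra K A]
  [Algebra.IsCentral K A] [Ring Ω] [Algebra K Ω]

/-- Shortest-relation argument. Normalize one coefficient to `1`; subtracting the relation
multiplied by `y` on the two sides removes that term, so by induction all coefficients commute with
`y`. They are then central, hence in `K`, against the independence of `l`. -/
theorem eq_zero_of_sum_mul_eq_zero (hA : ∀ a : A, a ≠ 0 → IsUnit a) (f : B →ₗ[K] Ω)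
    (hf : Function.Injective f) (g : A →ₐ[K] Ω) (hfg : ∀ x y, Commute (f x) (g y))
    {ι : Type*} {l : ι → B} (hl : LinearIndependent K l) (s : Finset ι) (a : ι → A)
    (h : ∑ i ∈ s, f (l i) * g (a i) = 0) : ∀ i ∈ s, a i = 0 := by
  classical
  induction s using Finset.induction_on generalizing a with
  | empty => simp
  | insert i₀ s hi₀ ih =>
    by_cases h0 : a i₀ = 0
    · rw [Finset.sum_insert hi₀, h0, map_zero, mul_zero, zero_add] at h
      intro i hi
      rcases Finset.mem_insert.mp hi with rfl | hi
      · exact h0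
      · exact ih a h i hi
    exfalso
    obtain ⟨w, hw⟩ := (hA _ h0).exists_right_inv
    have h1 : ∑ i ∈ insert i₀ s, f (l i) * g (a i * w) = 0 := by
      have := congrArg (· * g w) h
      simpa [Finset.sum_mul, mul_assoc] using this
    have hcomm : ∀ i ∈ s, ∀ y, y * (a i * w) = (a i * w) * y := by
      intro i hi y
      have h2 : ∑ i ∈ insert i₀ s, f (l i) * g (y * (a i * w) - (a i * w) * y) = 0 := by
        have e1 := congrArg (g y * ·) h1
        have e2 := congrArg (· * g y) h1
        simp only [Finset.mul_sum, Finset.sum_mul, mul_zero, zero_mul] at e1 e2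
        have e3 := congrArg₂ (· - ·) e1 e2
        simp only [← Finset.sum_sub_distrib, sub_zero] at e3
        rw [← e3]
        refine Finset.sum_congr rfl fun j _ => ?_
        rw [map_sub, map_mul g y, map_mul g _ y, mul_sub, ← mul_assoc, ← mul_assoc, ← mul_assoc,
          (hfg (l j) y).eq]
      rw [Finset.sum_insert hi₀, hw, mul_one, one_mul, sub_self, map_zero, mul_zero,
        zero_add] at h2
      exact sub_eq_zero.mp (ih _ h2 i hi)
    have hk : ∀ i, ∃ k : K, i ∈ insert i₀ s → algebraMap K A k = a i * w := by
      intro i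
      by_cases hi : i ∈ insert i₀ s
      · have hmem : a i * w ∈ Subalgebra.center K A := by
          rw [Subalgebra.mem_center_iff]
          intro y
          rcases Finset.mem_insert.mp hi with rfl | hi
          · rw [hw, mul_one, one_mul]
          · exact hcomm i hi y
        obtain ⟨k, hk⟩ := Algebra.mem_bot.mp (Algebra.IsCentral.out hmem)
        exact ⟨k, fun _ => hk⟩
      · exact ⟨0, fun h => absurd h hi⟩
    choose k hk using hk
    have h3 : ∑ i ∈ insert i₀ s, k i • l i = 0 := by
      apply hf
      rw [map_zero, map_sum, ← h1]
      refine Finset.sum_congr rfl fun i hi => ?_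
      rw [← hk i hi, AlgHom.commutes, map_smul, Algebra.smul_def, Algebra.commutes]
    have h4 := linearIndependent_iff'.mp hl _ k h3 i₀ (Finset.mem_insert_self _ _)
    have h5 := hk i₀ (Finset.mem_insert_self _ _)
    rw [h4, map_zero, hw] at h5
    have h6 : a i₀ = a i₀ * 1 := (mul_one _).symm
    rw [← h5, mul_zero] at h6
    exact h0 h6

/-- Expand an element of the kernel along a `K`-basis of `B`. No finiteness of `A` over `K` is
needed, so this can be used to prove finiteness. -/
theorem lift_injective [CommRing T] [Algebra K T] [Algebra T B] [IsScalarTower K T B]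
    [Algebra T Ω] [IsScalarTower K T Ω] (hA : ∀ a : A, a ≠ 0 → IsUnit a) (f : B →ₐ[T] Ω)
    (hf : Function.Injective f) (g : A →ₐ[K] Ω) (hfg : ∀ x y, Commute (f x) (g y)) :
    Function.Injective (Algebra.TensorProduct.lift f g hfg) := by
  classical
  rw [injective_iff_map_eq_zero]
  intro z hz
  let ℬ := Module.Basis.ofVectorSpace K B
  obtain ⟨c, rfl⟩ := (TensorProduct.equivFinsuppOfBasisLeft (N := A) ℬ).symm.surjective z
  have h1 : ∑ i ∈ c.support, (f.toLinearMap.restrictScalars K) (ℬ i) * g (c i) = 0 := by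
    rw [TensorProduct.equivFinsuppOfBasisLeft_symm_apply, Finsupp.sum, map_sum] at hz
    simpa using hz
  have h2 := eq_zero_of_sum_mul_eq_zero hA (f.toLinearMap.restrictScalars K) hf g hfg
    ℬ.linearIndependent c.support c h1
  have : c = 0 := by
    ext i
    by_contra hi
    exact hi (h2 i (Finsupp.mem_support_iff.mpr hi))
  rw [this, map_zero]

end TensorProduct

/-! ### The regular representation over a commutative subring. -/

section RegMatrix

variable {S A ι : Type*} [CommRing S] [Ring A] [Module S A] [IsScalarTower S A A] [Fintype ι]
  [DecidableEq ι]

/-- The matrix of right multiplication, `bᵢ a = Σⱼ (regMatrix b a)ᵢⱼ bⱼ`. -/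
noncomputable def regMatrix (b : Module.Basis ι S A) : A →+* Matrix ι ι S where
  toFun a := Matrix.of fun i j => b.repr (b i * a) j
  map_one' := by
    ext i j : 2
    simp [Matrix.one_apply, Finsupp.single_apply]
  map_zero' := by
    ext i j : 2
    simp
  map_add' a b := by
    ext i j : 2
    simp [mul_add]
  map_mul' a c := by
    ext i j : 2
    simp only [Matrix.of_apply, Matrix.mul_apply]
    conv_lhs => rw [← mul_assoc, ← b.sum_repr (b i * a), Finset.sum_mul]
    simp only [smul_mul_assoc, map_sum, map_smul, Finsupp.coe_finsetSum, Finset.sum_apply,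
      Finsupp.coe_smul, Pi.smul_apply, smul_eq_mul]

theorem regMatrix_apply (b : Module.Basis ι S A) (a : A) (i j : ι) :
    regMatrix b a i j = b.repr (b i * a) j := rfl

variable {K : Type*} [Field K] [Algebra K A] [Algebra K S] [IsScalarTower K S A]

/-- `regMatrix` as a homomorphism of algebras. -/
noncomputable def regAlgHom (K : Type*) [Field K] [Algebra K A] [Algebra K S]
    [IsScalarTower K S A] (b : Module.Basis ι S A) : A →ₐ[K] Matrix ι ι S :=
  { regMatrix b with
    commutes' := by
      intro k
      ext i j
      change b.repr (b i * algebraMap K A k) j = _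
      rw [← Algebra.commutes, ← Algebra.smul_def, ← algebraMap_smul S k (b i), map_smul,
        Matrix.algebraMap_matrix_apply]
      simp [Finsupp.single_apply, ← Algebra.algebraMap_eq_smul_one] }

/-- `S ⊗ A` embeds in a matrix ring of finite rank over `S`, and base change preserves rank. -/
theorem finite_of_basis [Nontrivial S] [Algebra.IsCentral K A] (hA : ∀ a : A, a ≠ 0 → IsUnit a)
    [Nonempty ι] (b : Module.Basis ι S A) : Module.Finite K A := by
  have hinj : Function.Injective (Algebra.TensorProduct.lift (Algebra.ofId S (Matrix ι ι S))
      (regAlgHom K b) fun x y => Algebra.commutes x _) := by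
    apply lift_injective hA
    exact FaithfulSMul.algebraMap_injective S (Matrix ι ι S)
  have h1 := LinearMap.lift_rank_le_of_injective (Algebra.TensorProduct.lift
      (Algebra.ofId S (Matrix ι ι S))
      (regAlgHom K b) fun x y => Algebra.commutes x _).toLinearMap hinj
  have h2 : Module.rank S (Matrix ι ι S) < Cardinal.aleph0 := Module.rank_lt_aleph0 S _
  rw [Module.rank_baseChange] at h1
  rw [← Module.rank_lt_aleph0_iff]
  rw [← Cardinal.lift_lt_aleph0, ← Cardinal.lift_lt_aleph0]
  refine h1.trans_lt ?_
  rw [Cardinal.lift_lt_aleph0]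
  exact h2

/-- Jacobson density. `A` is simple under right multiplications because nonzero elements are
invertible, and `hS`, saying that `S` contains its centralizer, forces the commutant to consist of
the scalars from `S`. So every `S`-linear endomorphism is a combination of right multiplications. -/
theorem span_range_regMatrix [IsDomain S] [Nontrivial A] (hA : ∀ a : A, a ≠ 0 → IsUnit a)
    (hS : ∀ a : A, (∀ s : S, (s • 1) * a = a * (s • 1)) → ∃ s : S, s • 1 = a)
    (b : Module.Basis ι S A) : Submodule.span S (Set.range (regMatrix b)) = ⊤ := by
  classical
  have : SMulCommClass Aᵐᵒᵖ S A := ⟨fun a s x => smul_mul_assoc s x a.unop⟩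
  let ρ : Aᵐᵒᵖ →+* Module.End S A := Module.toModuleEnd S A
  let V : Subalgebra S (Module.End S A) := Algebra.adjoin S (Set.range ρ)
  have hρ : ∀ a, ρ a ∈ V := fun a => Algebra.subset_adjoin ⟨a, rfl⟩
  have hsimple : IsSimpleModule V A := by
    rw [isSimpleModule_iff_toSpanSingleton_surjective]
    refine ⟨inferInstance, fun m hm y => ?_⟩
    obtain ⟨w, hw⟩ := (hA m hm).exists_right_inv
    refine ⟨⟨ρ (MulOpposite.op (w * y)), hρ _⟩, ?_⟩
    change m * (w * y) = y
    rw [← mul_assoc, hw, one_mul]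
  -- Commuting with right multiplications makes `g` left multiplication by `g 1`; linearity over `S`
  -- makes `g 1` commute with `S`.
  have hEnd : ∀ g : Module.End V A, ∃ s : S, ∀ m, g m = s • m := by
    intro g
    have hg : ∀ m, g m = g 1 * m := by
      intro m
      have := g.map_smul ⟨ρ (MulOpposite.op m), hρ _⟩ 1
      change g (1 * m) = g 1 * m at this
      rwa [one_mul] at this
    obtain ⟨s, hs⟩ := hS (g 1) (by
      intro s
      have := g.map_smul (algebraMap S V s) 1
      change g (s • 1) = s • g 1 at this
      rw [← hg, this, smul_mul_assoc, one_mul])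
    refine ⟨s, fun m => ?_⟩
    rw [hg, ← hs, smul_mul_assoc, one_mul]
  rw [eq_top_iff]
  intro M _
  let T : Module.End S A := Matrix.toLin b b M.transpose
  let T' : Module.End (Module.End V A) A :=
    { toFun := T
      map_add' := map_add T
      map_smul' := by
        intro g m
        obtain ⟨s, hs⟩ := hEnd g
        change T (g m) = g (T m)
        rw [hs, hs, map_smul] }
  obtain ⟨r, hr⟩ := jacobson_density (R := V) (M := A) T' (Finset.univ.image b)
  have hTr : T = r := by
    apply b.ext
    intro i
    exact hr (b i) (Finset.mem_image_of_mem _ (Finset.mem_univ _))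
  have hTV : T ∈ Submodule.span S (Set.range ρ) := by
    have h1 : T ∈ Subalgebra.toSubmodule V := by rw [hTr]; exact r.2
    rw [Algebra.adjoin_eq_span] at h1
    -- Right multiplications are closed under composition, so the algebra they generate is just
    -- their span.
    have h2 : (Submonoid.closure (Set.range ρ) : Set (Module.End S A)) = Set.range ρ := by
      have := Submonoid.closure_eq (MonoidHom.mrange (ρ : Aᵐᵒᵖ →* Module.End S A))
      exact congrArg (fun X : Submonoid _ => (X : Set (Module.End S A))) this
    rwa [h2] at h1
  -- `regMatrix` records images in rows and `LinearMap.toMatrix` in columns, hence the transpose.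
  let τ : Module.End S A →ₗ[S] Matrix ι ι S :=
    (Matrix.transposeLinearEquiv ι ι S S).toLinearMap ∘ₗ (LinearMap.toMatrix b b).toLinearMap
  have h1 := Submodule.mem_map_of_mem (f := τ) hTV
  rw [Submodule.map_span] at h1
  have h2 : τ T = M := by
    simp [τ, T]
  rw [h2] at h1
  refine Submodule.span_mono ?_ h1
  rintro _ ⟨_, ⟨a, rfl⟩, rfl⟩
  refine ⟨a.unop, ?_⟩
  ext i j
  change _ = LinearMap.toMatrix b b (ρ a) j i
  rw [LinearMap.toMatrix_apply]
  rfl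

end RegMatrix

/-! ### Determinants in a split form take values in the base field. -/

section GenericElement

variable {n : ℕ}

/-- The determinant of the vectors `Mʲ (1, …, 1)`, for `j < n`. -/
def cyclicDet {R : Type*} [CommRing R] (M : Matrix (Fin n) (Fin n) R) : R :=
  (Matrix.of fun k j : Fin n => ∑ l, (M ^ (j : ℕ)) k l).det

theorem map_cyclicDet {R R' : Type*} [CommRing R] [CommRing R'] (f : R →+* R')
    (M : Matrix (Fin n) (Fin n) R) : f (cyclicDet M) = cyclicDet (f.mapMatrix M) := by
  rw [cyclicDet, RingHom.map_det, cyclicDet]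
  congr 1
  ext k j
  simp only [RingHom.mapMatrix_apply, Matrix.map_apply, Matrix.of_apply, map_sum]
  simp only [← RingHom.mapMatrix_apply, ← map_pow]
  rfl

/-- A nonzero `cyclicDet` says that `(1, …, 1)` is a cyclic vector; applying `P(M)` to it gives a
linear relation between independent vectors. -/
theorem eq_zero_of_aeval_eq_zero_of_cyclicDet_ne_zero {L : Type*} [Field L]
    {M : Matrix (Fin n) (Fin n) L} (hM : cyclicDet M ≠ 0) {P : L[X]} (hP : P.degree < n)
    (h : aeval M P = 0) : P = 0 := by
  have h1 : (Matrix.of fun k j : Fin n => ∑ l, (M ^ (j : ℕ)) k l).mulVec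
      (fun j : Fin n => P.coeff j) = 0 := by
    ext k
    rcases eq_or_ne P 0 with rfl | hP0
    · simp [Matrix.mulVec, dotProduct]
    have h2 := congrFun (congrArg (fun Y : Matrix (Fin n) (Fin n) L => Y.mulVec 1) h) k
    rw [aeval_eq_sum_range' ((natDegree_lt_iff_degree_lt hP0).mpr hP), Finset.sum_range] at h2
    simp only [Matrix.sum_mulVec, Matrix.smul_mulVec, Matrix.zero_mulVec] at h2
    rw [← h2]
    simp [Matrix.mulVec, dotProduct, Finset.sum_apply, mul_comm]
  have h2 := Matrix.eq_zero_of_mulVec_eq_zero hM h1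
  ext i
  by_cases hi : i < n
  · exact congrFun h2 ⟨i, hi⟩
  · exact coeff_eq_zero_of_degree_lt (hP.trans_le (by exact_mod_cast not_lt.mp hi))

theorem cyclicDet_diagonal_ne_zero {L : Type*} [Field L] {w : Fin n → L}
    (hw : Function.Injective w) : cyclicDet (Matrix.diagonal w) ≠ 0 := by
  have : cyclicDet (Matrix.diagonal w) = (Matrix.vandermonde w).det := by
    unfold cyclicDet
    congr 1
    ext k j
    simp [Matrix.diagonal_pow, Matrix.diagonal_apply, Matrix.vandermonde]
  rw [this]
  exact Matrix.det_vandermonde_ne_zero_iff.mpr hw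

/-- A polynomial over `L` with infinitely many values over `K` in `K` has coefficients in `K`. -/
theorem coeff_mem_range_of_infinite {K L : Type*} [Field K] [Field L] [Algebra K L] (r : L[X])
    (h : {u : K | r.eval (algebraMap K L u) ∈ Set.range (algebraMap K L)}.Infinite) (i : ℕ) :
    r.coeff i ∈ Set.range (algebraMap K L) := by
  by_contra hi
  have hi' : r.coeff i ∉ LinearMap.range (Algebra.linearMap K L) := hi
  -- `ℓ` is a `K`-linear functional on `L` that kills `K` but not the offending coefficient; applied
  -- to the coefficients of `r` it gives a polynomial with infinitely many roots.
  obtain ⟨ℓ, hℓ, hle⟩ := Submodule.exists_le_ker_of_notMem hi'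
  let q : K[X] := ∑ j ∈ Finset.range (r.natDegree + 1), monomial j (ℓ (r.coeff j))
  have hq : ∀ u : K, q.eval u = ℓ (r.eval (algebraMap K L u)) := by
    intro u
    rw [eval_eq_sum_range (p := r), map_sum, eval_finsetSum]
    refine Finset.sum_congr rfl fun j _ => ?_
    rw [eval_monomial, mul_comm (r.coeff j), ← map_pow, ← Algebra.smul_def, map_smul,
      smul_eq_mul, mul_comm]
  have hq0 : q = 0 := by
    refine eq_zero_of_infinite_isRoot q (h.mono ?_)
    rintro u ⟨y, hy⟩
    change q.eval u = 0
    rw [hq, ← hy]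
    exact hle ⟨y, rfl⟩
  have h1 : q.coeff i = ℓ (r.coeff i) := by
    simp only [q, finsetSum_coeff, coeff_monomial]
    rw [Finset.sum_ite_eq']
    split_ifs with hlt
    · rfl
    · rw [coeff_eq_zero_of_natDegree_lt (by simpa using hlt), map_zero]
  exact hℓ (by rw [← h1, hq0, coeff_zero])

variable {K L A : Type*} [Field K] [Field L] [Algebra K L] [Ring A] [Algebra K A]

/-- A `K`-linear retraction `ℓ : L → K`, applied to the coefficients of the characteristic
polynomial, gives a polynomial over `K` that still annihilates `y`. Both have top coefficient `1` in
degree `n`, so their difference has degree below `n` and kills a cyclic matrix: they coincide. -/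
theorem det_mem_range_of_cyclicDet_ne_zero (ψ : L ⊗[K] A →ₐ[L] Matrix (Fin n) (Fin n) L)
    (hψ : Function.Injective ψ) (y : A) (hy : cyclicDet (ψ (1 ⊗ₜ y)) ≠ 0) :
    (ψ (1 ⊗ₜ y)).det ∈ Set.range (algebraMap K L) := by
  set M := ψ (1 ⊗ₜ y) with hM
  set χ := M.charpoly with hχ
  have hdeg : χ.natDegree = n := by simp [hχ, Matrix.charpoly_natDegree_eq_dim]
  have hmonic : χ.Monic := Matrix.charpoly_monic M
  obtain ⟨ℓ, hℓ⟩ := (Algebra.linearMap K L).exists_leftInverse_of_injective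
    (LinearMap.ker_eq_bot.mpr (algebraMap K L).injective)
  have hℓ1 : ℓ 1 = 1 := by simpa using LinearMap.congr_fun hℓ 1
  have h1 : ∑ i ∈ Finset.range (n + 1), χ.coeff i ⊗ₜ[K] (y ^ i) = 0 := by
    apply hψ
    have h2 := Matrix.aeval_self_charpoly M
    rw [aeval_eq_sum_range, hdeg] at h2
    rw [map_zero, ← h2, map_sum]
    refine Finset.sum_congr rfl fun i _ => ?_
    rw [hM, ← map_pow, ← map_smul, Algebra.TensorProduct.tmul_pow, one_pow,
      TensorProduct.smul_tmul', smul_eq_mul, mul_one]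
  let P : K[X] := ∑ i ∈ Finset.range (n + 1), monomial i (ℓ (χ.coeff i))
  have hPc : ∀ i, P.coeff i = ℓ (χ.coeff i) := by
    intro i
    simp only [P, finsetSum_coeff, coeff_monomial]
    rw [Finset.sum_ite_eq']
    split_ifs with hlt
    · rfl
    · rw [coeff_eq_zero_of_natDegree_lt (by rw [hdeg]; simpa using hlt), map_zero]
  have hPy : aeval y P = 0 := by
    have h2 := congrArg ((TensorProduct.lid K A).toLinearMap ∘ₗ LinearMap.rTensor A ℓ) h1
    simp only [map_sum, map_zero, LinearMap.comp_apply, LinearEquiv.coe_coe,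
      LinearMap.rTensor_tmul, TensorProduct.lid_tmul] at h2
    simp only [P, map_sum, aeval_monomial, ← Algebra.smul_def]
    exact h2
  have hPχ : P.map (algebraMap K L) = χ := by
    rw [← sub_eq_zero]
    apply eq_zero_of_aeval_eq_zero_of_cyclicDet_ne_zero hy
    · rw [degree_lt_iff_coeff_zero]
      intro i hi
      rw [coeff_sub, coeff_map, hPc]
      rcases (hi : n ≤ i).eq_or_lt with rfl | hi
      · have : χ.coeff n = 1 := by
          have := hmonic.coeff_natDegree
          rwa [hdeg] at this
        rw [this, hℓ1, map_one, sub_self]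
      · rw [coeff_eq_zero_of_natDegree_lt (by rwa [hdeg]), map_zero, map_zero, sub_self]
    · rw [map_sub, Matrix.aeval_self_charpoly, sub_zero, aeval_map_algebraMap]
      have h3 : M = ((ψ.restrictScalars K).comp Algebra.TensorProduct.includeRight) y := rfl
      rw [h3, aeval_algHom_apply, hPy, map_zero]
  rw [Matrix.det_eq_sign_charpoly_coeff, ← hχ, ← hPχ, coeff_map]
  exact ⟨(-1) ^ Fintype.card (Fin n) * P.coeff 0, by simp⟩

/-- Being cyclic is a Zariski-open condition. Surjectivity supplies a point over `L`, and as `K` is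
infinite there is then one over `K`. -/
theorem exists_cyclicDet_ne_zero [Infinite K] (ψ : L ⊗[K] A →ₐ[L] Matrix (Fin n) (Fin n) L)
    (hψ : Function.Surjective ψ) : ∃ y : A, cyclicDet (ψ (1 ⊗ₜ y)) ≠ 0 := by
  have hinj : Function.Injective (algebraMap K L) := (algebraMap K L).injective
  let w : Fin n → L := fun i => algebraMap K L (Infinite.natEmbedding K i)
  have hw : Function.Injective w := fun i j h =>
    Fin.ext ((Infinite.natEmbedding K).injective (hinj h))
  obtain ⟨z, hz⟩ := hψ (Matrix.diagonal w)
  obtain ⟨s, hs⟩ := TensorProduct.exists_finset z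
  -- The generic combination of the right factors of the simple tensors summing to `z`; specializing
  -- each variable to its left factor recovers the diagonal matrix.
  let G : Matrix (Fin n) (Fin n) (MvPolynomial (L × A) L) :=
    ∑ i ∈ s, (MvPolynomial.X i : MvPolynomial (L × A) L) •
      (MvPolynomial.C : L →+* _).mapMatrix (ψ (1 ⊗ₜ i.2))
  have hG : ∀ ξ : L × A → L, (MvPolynomial.eval ξ).mapMatrix G =
      ∑ i ∈ s, ξ i • ψ (1 ⊗ₜ i.2) := by
    intro ξ
    simp only [G, map_sum]
    refine Finset.sum_congr rfl fun i _ => ?_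
    ext k l
    simp
  have hne : cyclicDet G ≠ 0 := by
    intro h0
    have h1 := map_cyclicDet (MvPolynomial.eval fun i : L × A => i.1) G
    rw [h0, map_zero, hG] at h1
    have h2 : ∑ i ∈ s, i.1 • ψ (1 ⊗ₜ i.2) = Matrix.diagonal w := by
      rw [← hz, hs, map_sum]
      refine Finset.sum_congr rfl fun i _ => ?_
      rw [← map_smul, TensorProduct.smul_tmul', smul_eq_mul, mul_one]
    rw [h2] at h1
    exact cyclicDet_diagonal_ne_zero hw h1.symm
  by_contra hcon
  push Not at hcon
  apply hne
  refine MvPolynomial.funext_set (fun _ => Set.range (algebraMap K L))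
    (fun _ => Set.infinite_range_of_injective hinj) fun ξ hξ => ?_
  choose k hk using fun i => hξ i (Set.mem_univ i)
  rw [map_cyclicDet, hG, map_zero, ← hcon (∑ i ∈ s, k i • i.2), TensorProduct.tmul_sum, map_sum]
  congr 1
  refine Finset.sum_congr rfl fun i _ => ?_
  rw [← hk i, TensorProduct.tmul_smul, algebraMap_smul]
  exact (ψ.toLinearMap.map_smul_of_tower _ _).symm

/-- Move along the line `u a + y` with `y` cyclic. For all but finitely many `u` in `K` the point is
cyclic and its determinant lies in `K`; the determinant is a polynomial in `u` whose coefficient in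
degree `n` is that of `a`. -/
theorem det_mem_range [Infinite K] (ψ : L ⊗[K] A →ₐ[L] Matrix (Fin n) (Fin n) L)
    (hψ : Function.Bijective ψ) (a : A) : (ψ (1 ⊗ₜ a)).det ∈ Set.range (algebraMap K L) := by
  obtain ⟨y, hy⟩ := exists_cyclicDet_ne_zero ψ hψ.2
  let G : Matrix (Fin n) (Fin n) L[X] :=
    (X : L[X]) • (ψ (1 ⊗ₜ a)).map C + (ψ (1 ⊗ₜ y)).map C
  have hG : ∀ ξ : L, (evalRingHom ξ).mapMatrix G = ξ • ψ (1 ⊗ₜ a) + ψ (1 ⊗ₜ y) := by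
    intro ξ
    ext k l
    simp only [G, RingHom.mapMatrix_apply, Matrix.map_apply, Matrix.add_apply, Matrix.smul_apply,
      smul_eq_mul, coe_evalRingHom, eval_add, eval_mul, eval_X, eval_C]
  have hGK : ∀ u : K, (evalRingHom (algebraMap K L u)).mapMatrix G = ψ (1 ⊗ₜ (u • a + y)) := by
    intro u
    rw [hG, TensorProduct.tmul_add, map_add, TensorProduct.tmul_smul, algebraMap_smul]
    congr 1
    exact (ψ.toLinearMap.map_smul_of_tower _ _).symm
  have hne : cyclicDet G ≠ 0 := by
    intro h0
    have h1 := map_cyclicDet (evalRingHom (0 : L)) G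
    rw [h0, map_zero, hG, zero_smul, zero_add] at h1
    exact hy h1.symm
  have h1 : G.det.coeff (Fintype.card (Fin n)) = (ψ (1 ⊗ₜ a)).det := by
    exact coeff_det_X_add_C_card _ _
  rw [← h1]
  apply coeff_mem_range_of_infinite
  have hfin : {u : K | (cyclicDet G).eval (algebraMap K L u) = 0}.Finite := by
    have := (finite_setOfPred_isRoot hne).preimage ((algebraMap K L).injective.injOn (s := _))
    exact this
  refine (Set.Finite.infinite_compl hfin).mono ?_
  intro u hu
  rw [Set.mem_ofPred_eq, ← coe_evalRingHom, RingHom.map_det, hGK]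
  apply det_mem_range_of_cyclicDet_ne_zero ψ hψ.1
  rw [← hGK, ← map_cyclicDet]
  exact hu

end GenericElement

/-! ### The reduced norm as a regular determinant. -/

section ReducedNorm

variable {K : Type u} {A : Type v} [Field K] [Ring A] [Algebra K A]

/-- `det_mem_range` rules out the junk value. The choice of splitting is harmless, since algebra
isomorphisms between matrix algebras preserve determinants. -/
theorem reducedNorm_spec [Infinite K] {n : ℕ}
    (ψ : (AlgebraicClosure K ⊗[K] A) ≃ₐ[AlgebraicClosure K]
      Matrix (Fin n) (Fin n) (AlgebraicClosure K)) (a : A) :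
    algebraMap K (AlgebraicClosure K) (reducedNorm K A a) = (ψ (1 ⊗ₜ[K] a)).det := by
  obtain ⟨β, hβ⟩ := det_mem_range ψ.toAlgHom ψ.bijective a
  have h : ∃ (b : K) (n : ℕ) (φ : (AlgebraicClosure K ⊗[K] A) ≃ₐ[AlgebraicClosure K]
      Matrix (Fin n) (Fin n) (AlgebraicClosure K)),
      algebraMap K (AlgebraicClosure K) b = (φ (1 ⊗ₜ[K] a)).det := ⟨β, n, ψ, hβ⟩
  rw [reducedNorm, dif_pos h]
  obtain ⟨n', φ, hφ⟩ := h.choose_spec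
  rw [hφ, ← Matrix.det_map (ψ.symm.trans φ) (ψ (1 ⊗ₜ[K] a))]
  simp

/-- Once `S` is embedded in the algebraic closure, the regular representation extends to a
splitting: it is injective by `lift_injective` and surjective by `span_range_regMatrix`. -/
theorem det_regMatrix_eq_reducedNorm [Infinite K] [Nontrivial A] [Algebra.IsCentral K A]
    (hA : ∀ a : A, a ≠ 0 → IsUnit a) {S : Type*} [CommRing S] [IsDomain S] [Algebra K S]
    [Module S A] [IsScalarTower S A A] [IsScalarTower K S A]
    (hS : ∀ a : A, (∀ s : S, (s • 1) * a = a * (s • 1)) → ∃ s : S, s • 1 = a)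
    {ι : Type*} [Fintype ι] [DecidableEq ι] (b : Module.Basis ι S A) (a : A) :
    (regMatrix b a).det = algebraMap K S (reducedNorm K A a) := by
  have : Nonempty ι := b.index_nonempty
  have hfin : Module.Finite K A := finite_of_basis hA b
  let j : S →ₗ[K] A :=
    { toFun := fun s => s • 1
      map_add' := fun x y => add_smul _ _ _
      map_smul' := fun k s => smul_assoc _ _ _ }
  have hj : Function.Injective j := by
    rw [injective_iff_map_eq_zero]
    intro s hs
    obtain ⟨i⟩ := ‹Nonempty ι›
    have h1 : s • b i = 0 := by
      have : s • b i = (s • (1 : A)) * b i := by rw [smul_mul_assoc, one_mul]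
      rw [this]
      change j s * b i = 0
      rw [hs, zero_mul]
    have h2 := congrArg (fun y => b.repr y i) h1
    simpa using h2
  have : Module.Finite K S := Module.Finite.of_injective j hj
  -- This needs `S` algebraic over `K`, which follows from finiteness. A domain integral over a
  -- field is a field, so `ε` is injective.
  let ε : S →ₐ[K] AlgebraicClosure K := IsAlgClosed.lift
  have hε : Function.Injective ε := by
    let _ : Field S := (Algebra.IsIntegral.isField_iff_isField
      (algebraMap K S).injective |>.mp (Field.toIsField K)).toField
    exact (ε : S →+* AlgebraicClosure K).injective
  let g : A →ₐ[K] Matrix ι ι (AlgebraicClosure K) := (ε.mapMatrix).comp (regAlgHom K b)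
  let ψ : (AlgebraicClosure K ⊗[K] A) →ₐ[AlgebraicClosure K] Matrix ι ι (AlgebraicClosure K) :=
    Algebra.TensorProduct.lift (Algebra.ofId _ _) g fun x y => Algebra.commutes x _
  have hψ1 : ∀ a, ψ (1 ⊗ₜ a) = g a := by 
    intro a
    change algebraMap (AlgebraicClosure K) (Matrix ι ι (AlgebraicClosure K)) 1 * g a = g a
    rw [map_one, one_mul]
  have hinj : Function.Injective ψ := by
    apply lift_injective hA
    exact FaithfulSMul.algebraMap_injective _ (Matrix ι ι (AlgebraicClosure K))
  have hsurj : Function.Surjective ψ := by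
    -- The range contains the image of all matrices over `S`, in particular the matrix units.
    have hmem : ∀ M : Matrix ι ι S, ε.mapMatrix M ∈ ψ.range := by
      intro M
      have hM : M ∈ Submodule.span S (Set.range (regMatrix b)) := by
        rw [span_range_regMatrix hA hS b]; trivial
      induction hM using Submodule.span_induction with
      | mem M hM =>
        obtain ⟨a, rfl⟩ := hM
        exact ⟨1 ⊗ₜ a, hψ1 a⟩
      | zero => rw [map_zero]; exact zero_mem _
      | add x y _ _ hx hy => rw [map_add]; exact add_mem hx hy
      | smul s x _ hx =>
        have : ε.mapMatrix (s • x) = ε s • ε.mapMatrix x := by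
          ext i j
          simp
        rw [this]
        exact Subalgebra.smul_mem _ hx _
    intro M
    rw [← AlgHom.mem_range, Matrix.matrix_eq_sum_single M]
    refine sum_mem fun i _ => sum_mem fun j _ => ?_
    have h1 : Matrix.single i j (M i j) = M i j • ε.mapMatrix (Matrix.single i j (1 : S)) := by
      ext k l
      simp [Matrix.single_apply]
    rw [h1]
    exact Subalgebra.smul_mem _ (hmem _) _
  let e := Fintype.equivFin ι
  let Ψ := (AlgEquiv.ofBijective ψ ⟨hinj, hsurj⟩).trans
    (Matrix.reindexAlgEquiv (AlgebraicClosure K) (AlgebraicClosure K) e)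
  have h1 := reducedNorm_spec Ψ a
  have h2 : (Ψ (1 ⊗ₜ[K] a)).det = ε ((regMatrix b a).det) := by
    have : Ψ (1 ⊗ₜ[K] a) = Matrix.reindex e e (g a) := by
      rw [← hψ1]
      rfl
    rw [this, Matrix.det_reindex_self, AlgHom.map_det]
    rfl
  apply hε
  rw [← h2, ← h1, AlgHom.commutes]

end ReducedNorm

/-! ### Subfields of degree `d` are their own centralizers -/

instance Subring.isCentral_center {D : Type*} [Ring D] : Algebra.IsCentral (Subring.center D) D where
  out := by
    intro a ha
    rw [Subalgebra.mem_center_iff] at ha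
    exact ⟨⟨a, Subring.mem_center_iff.mpr ha⟩, rfl⟩

/-- The injection of `E ⊗ D` into `M_d(E)` is onto because both sides have dimension `d ^ 3` over
the center. Left multiplication by `z` is `E`-linear and commutes with right multiplications, so its
matrix is central, hence a scalar from `E`. -/
theorem mem_of_forall_commute {D : Type u} [DivisionRing D] [Module.Finite (Subring.center D) D]
    {d : ℕ} (hd : Module.finrank (Subring.center D) D = d ^ 2)
    (E : Subalgebra (Subring.center D) D) [IsMulCommutative E]
    (hEd : Module.finrank (Subring.center D) E = d) (v : Module.Basis (Fin d) E D)
    (z : D) (hz : ∀ e ∈ E, z * e = e * z) : z ∈ E := by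
  let Λ := Algebra.TensorProduct.lift (Algebra.ofId E (Matrix (Fin d) (Fin d) E))
    (regAlgHom (Subring.center D) v) fun x y => Algebra.commutes x _
  have hne : Nonempty (Fin d) := v.index_nonempty
  have hinj : Function.Injective Λ :=
    lift_injective (fun a ha => IsUnit.mk0 a ha) _
      (FaithfulSMul.algebraMap_injective E (Matrix (Fin d) (Fin d) E)) _ _
  have hsurj : Function.Surjective Λ := by
    have h1 : Module.finrank (Subring.center D) (E ⊗[Subring.center D] D) =
        Module.finrank (Subring.center D) (Matrix (Fin d) (Fin d) E) := by
      rw [Module.finrank_tensorProduct, Module.finrank_matrix, hEd, hd]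
      simp
      ring
    exact (LinearMap.injective_iff_surjective_of_finrank_eq_finrank
      (f := Λ.toLinearMap.restrictScalars (Subring.center D)) h1).mp hinj
  have hzE : ∀ (e : E) (a : D), z * (e • a) = e • (z * a) := by
    intro e a
    change z * ((e : D) * a) = (e : D) * (z * a)
    rw [← mul_assoc, hz e e.2, mul_assoc]
  let Z : Matrix (Fin d) (Fin d) E := Matrix.of fun i j => v.repr (z * v i) j
  have hZ : ∀ i, ∑ j, Z i j • v j = z * v i := fun i => v.sum_repr _
  have hcomm : ∀ M : Matrix (Fin d) (Fin d) E, Commute Z M := by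
    intro M
    obtain ⟨τ, rfl⟩ := hsurj M
    induction τ using TensorProduct.induction_on with
    | zero => rw [map_zero]; exact Commute.zero_right _
    | add x y hx hy => rw [map_add]; exact hx.add_right hy
    | tmul e a =>
      change Commute Z (algebraMap E (Matrix (Fin d) (Fin d) E) e * regMatrix v a)
      refine Commute.mul_right (Algebra.commutes _ _).symm ?_
      ext i j : 2
      have h1 : z * (v i * a) = ∑ j, (Z * regMatrix v a) i j • v j := by
        rw [← mul_assoc, ← hZ i, Finset.sum_mul]
        simp only [Matrix.mul_apply, Finset.sum_smul, mul_smul]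
        rw [Finset.sum_comm]
        refine Finset.sum_congr rfl fun k _ => ?_
        rw [smul_mul_assoc, ← Finset.smul_sum]
        congr 1
        exact (v.sum_repr _).symm
      have h2 : z * (v i * a) = ∑ j, (regMatrix v a * Z) i j • v j := by
        rw [← v.sum_repr (v i * a), Finset.mul_sum]
        simp only [Matrix.mul_apply, Finset.sum_smul, mul_smul]
        rw [Finset.sum_comm]
        refine Finset.sum_congr rfl fun k _ => ?_
        rw [hzE, ← Finset.smul_sum, hZ]
        rfl
      have h3 := congrArg (fun y => v.repr y j) (h1.symm.trans h2)
      simp only [v.repr_sum_self] at h3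
      rw [h3]
  obtain ⟨e, he⟩ := (Matrix.mem_range_scalar_iff_commute_single (M := Z)).mpr
    fun i j _ => (hcomm _).symm
  obtain ⟨i⟩ := hne
  have h1 := hZ i
  rw [← he] at h1
  simp only [Matrix.scalar_apply, Matrix.diagonal_apply, ite_smul, zero_smul, Finset.sum_ite_eq,
    Finset.mem_univ, if_true] at h1
  have h2 : (e : D) * v i = z * v i := h1
  rw [← mul_right_cancel₀ (v.ne_zero i) h2]
  exact e.2

/-! ### Powers of a derivation on the center -/

namespace RingDerivation

variable {D : Type u} [DivisionRing D] (δ : RingDerivation D)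

/-- Shortest relation again, with top coefficient normalized to `1`. Commutators with elements of
`D` show that the coefficients are central, and differentiating shows that they are constants. They
then form a polynomial over `F` of degree `n` annihilating `δ|_C`, of degree too small for the
minimal polynomial. -/
theorem eq_zero_of_forall_sum_iterate_eq_zero (n : ℕ)
    (hn : n ≤ (minpoly δ.centralConst δ.centerEnd).natDegree) (h : ℕ → D)
    (hsum : ∀ c ∈ Subring.center D, ∑ r ∈ Finset.range n, h r * δ^[r] c = 0) :
    ∀ r < n, h r = 0 := by
  induction n generalizing h with
  | zero => intro r hr; omega
  | succ n ih =>
    by_cases h0 : h n = 0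
    · intro r hr
      rcases (Nat.lt_succ_iff_lt_or_eq.mp hr) with hr | rfl
      · refine ih (by omega) h (fun c hc => ?_) r hr
        have := hsum c hc
        rwa [Finset.sum_range_succ, h0, zero_mul, add_zero] at this
      · exact h0
    exfalso
    set k : ℕ → D := fun r => (h n)⁻¹ * h r with hk
    have hkn : k n = 1 := inv_mul_cancel₀ h0
    have hksum : ∀ c ∈ Subring.center D, ∑ r ∈ Finset.range (n + 1), k r * δ^[r] c = 0 := by
      intro c hc
      have := congrArg ((h n)⁻¹ * ·) (hsum c hc)
      simpa [Finset.mul_sum, hk, mul_assoc] using this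
    have hit : ∀ c ∈ Subring.center D, ∀ r, δ^[r] c ∈ Subring.center D := by
      intro c hc r
      induction r with
      | zero => exact hc
      | succ r ihr => rw [Function.iterate_succ_apply']; exact δ.map_mem_center ihr
    have hcen : ∀ r < n, k r ∈ Subring.center D := by
      intro r hr
      rw [Subring.mem_center_iff]
      intro a
      rw [← sub_eq_zero]
      refine ih (by omega) (fun r => a * k r - k r * a) (fun c hc => ?_) r hr
      have e1 := congrArg (a * ·) (hksum c hc)
      have e2 := congrArg (· * a) (hksum c hc)
      simp only [Finset.mul_sum, Finset.sum_mul, mul_zero, zero_mul] at e1 e2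
      have e3 := congrArg₂ (· - ·) e1 e2
      simp only [← Finset.sum_sub_distrib, sub_zero] at e3
      rw [Finset.sum_range_succ, hkn, one_mul,
        Subring.mem_center_iff.mp (hit c hc n) a, sub_self, add_zero] at e3
      rw [← e3]
      refine Finset.sum_congr rfl fun j _ => ?_
      rw [sub_mul, mul_assoc a (k j), mul_assoc (k j) a, mul_assoc (k j) _ a,
        Subring.mem_center_iff.mp (hit c hc j) a]
    -- Differentiating the relation at `c` and subtracting the relation at `δ c` leaves the
    -- coefficients `δ (k r)`; the top one vanishes since `δ 1 = 0`.
    have hcon : ∀ r < n, δ (k r) = 0 := by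
      refine ih (by omega) (fun r => δ (k r)) (fun c hc => ?_)
      have e1 := hksum (δ c) (δ.map_mem_center hc)
      have e2 := congrArg (fun y => δ y) (hksum c hc)
      simp only [map_sum, map_zero, δ.leibniz, ← Function.iterate_succ_apply'] at e2
      simp only [← Function.iterate_succ_apply] at e1
      rw [Finset.sum_add_distrib, e1, zero_add, Finset.sum_range_succ, hkn, δ.map_one, zero_mul,
        add_zero] at e2
      exact e2
    have hF : ∀ r, ∃ c : δ.centralConst, r ≤ n → algebraMap δ.centralConst D c = k r := by
      intro r
      by_cases hr : r < n
      · exact ⟨⟨⟨k r, hcen r hr⟩, hcon r hr⟩, fun _ => rfl⟩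
      -- Only `r = n` matters here, where `k n = 1`; beyond that, `1` is a default.
      · refine ⟨1, fun hr' => ?_⟩
        rw [show r = n by omega, hkn, _root_.map_one]
    choose c hc using hF
    let P : δ.centralConst[X] := ∑ r ∈ Finset.range (n + 1), monomial r (c r)
    have hPc : P.coeff n = 1 := by
      simp only [P, finsetSum_coeff, coeff_monomial, Finset.sum_ite_eq', Finset.mem_range,
        Nat.lt_succ_self, if_true]
      apply (algebraMap δ.centralConst D).injective
      rw [hc n le_rfl, hkn, _root_.map_one]
    have hP0 : P ≠ 0 := by
      intro hP
      rw [hP, coeff_zero] at hPc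
      exact zero_ne_one hPc
    have hpow : ∀ (r : ℕ) (y : Subring.center D), (((δ.centerEnd ^ r) y : Subring.center D) : D) =
        δ^[r] (y : D) := by
      intro r y
      induction r with
      | zero => rfl
      | succ r ihr =>
        rw [pow_succ', Function.iterate_succ_apply', ← ihr]
        rfl
    have hPδ : aeval δ.centerEnd P = 0 := by
      ext y
      simp only [P, map_sum, aeval_monomial, LinearMap.sum_apply, LinearMap.zero_apply]
      rw [show ((0 : Subring.center D) : D) = 0 from rfl, ← hksum y y.2,
        AddSubmonoidClass.coe_finsetSum]
      refine Finset.sum_congr rfl fun r hr => ?_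
      rw [← hc r (by simpa [Nat.lt_succ_iff] using hr), ← hpow]
      rfl
    have h1 := natDegree_le_natDegree (minpoly.degree_le_of_ne_zero δ.centralConst _ hP0 hPδ)
    have h2 : P.natDegree ≤ n := by
      refine natDegree_sum_le_of_forall_le _ _ fun r hr => ?_
      exact (natDegree_monomial_le _).trans (by simpa [Nat.lt_succ_iff] using hr)
    omega

end RingDerivation

/-! ### Leading terms in `t`, and moving powers of `t` past constants. -/

namespace DiffPoly

section Ring

variable {D : Type u} [Ring D] {δ : RingDerivation D}

theorem coeff_tMul_pow_add (g : D[X]) (m : ℕ) (hg : g.natDegree ≤ m) (i : ℕ) :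
    ((tMul δ ^ i) g).coeff (m + i) = g.coeff m := by
  induction i with
  | zero => rfl
  | succ i ih =>
    rw [pow_succ', ← add_assoc]
    change (X * (tMul δ ^ i) g + coeffDer δ ((tMul δ ^ i) g)).coeff (m + i + 1) = _
    rw [coeff_add, coeff_X_mul, coeff_coeffDer, ih,
      coeff_tMul_pow_of_lt δ g i _ (by omega)]
    simp

/-- `h` has degree at most `n` in `t`, and `a` is its coefficient in degree `n`. -/
def HasLead (h : DiffPoly δ) (n : ℕ) (a : D) : Prop :=
  (toPoly δ h).natDegree ≤ n ∧ (toPoly δ h).coeff n = a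

theorem HasLead.coeff_of_lt {h : DiffPoly δ} {n : ℕ} {a : D} (hh : HasLead h n a) {k : ℕ}
    (hk : n < k) : (toPoly δ h).coeff k = 0 :=
  coeff_eq_zero_of_natDegree_lt (hh.1.trans_lt hk)

theorem HasLead.mul {h k : DiffPoly δ} {n m : ℕ} {a b : D} (hh : HasLead h n a)
    (hk : HasLead k m b) : HasLead (h * k) (n + m) (a * b) := by
  have h1 : toPoly δ (h * k) =
      ∑ i ∈ Finset.range (n + 1), (toPoly δ h).coeff i • (tMul δ ^ i) (toPoly δ k) := by
    rw [toPoly_mul, leftMul, eval₂_eq_sum_range' _ (Nat.lt_succ_of_le hh.1)]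
    exact AddMonoidHom.finsetSum_apply _ _ _
  constructor
  · rw [natDegree_le_iff_coeff_eq_zero]
    intro l hl
    rw [h1, finsetSum_coeff]
    refine Finset.sum_eq_zero fun i hi => ?_
    have hi' := Finset.mem_range.mp hi
    have := hk.1
    rw [coeff_smul, coeff_tMul_pow_of_lt δ _ i _ (by omega), smul_zero]
  · rw [h1, finsetSum_coeff, Finset.sum_eq_single n]
    · rw [coeff_smul, add_comm n m, coeff_tMul_pow_add _ _ hk.1, smul_eq_mul, hh.2, hk.2]
    · intro i hi hne
      have hi' := Finset.mem_range.mp hi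
      have := hk.1
      rw [coeff_smul, coeff_tMul_pow_of_lt δ _ i _ (by omega), smul_zero]
    · intro h'
      exact absurd (Finset.mem_range.mpr (Nat.lt_succ_self _)) h'

theorem hasLead_const (a : D) : HasLead (const δ a) 0 a :=
  ⟨(natDegree_C a).le, coeff_C_zero⟩

theorem hasLead_t_pow (n : ℕ) : HasLead (t δ ^ n) n 1 := by
  have h := const_mul_t_pow δ 1 n
  rw [map_one, one_mul] at h
  rw [h]
  exact ⟨natDegree_monomial_le _, coeff_monomial_same _ _⟩

theorem HasLead.pow {h : DiffPoly δ} {n : ℕ} (hh : HasLead h n 1) (k : ℕ) :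
    HasLead (h ^ k) (n * k) 1 := by
  induction k with
  | zero =>
    have := hasLead_const (δ := δ) 1
    rwa [map_one] at this
  | succ k ih =>
    have := ih.mul hh
    rwa [mul_one] at this

theorem eq_sum_const_mul_t_pow (h : DiffPoly δ) :
    h = ∑ i ∈ Finset.range ((toPoly δ h).natDegree + 1),
      const δ ((toPoly δ h).coeff i) * t δ ^ i := by
  apply (toPoly δ).injective
  simp only [const_mul_t_pow, map_sum, AddEquiv.apply_symm_apply]
  exact (toPoly δ h).as_sum_range

theorem mem_center_of_commute {y : DiffPoly δ} (hc : ∀ a, Commute y (const δ a))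
    (ht : Commute y (t δ)) : y ∈ Subring.center (DiffPoly δ) := by
  rw [Subring.mem_center_iff]
  intro h
  rw [eq_sum_const_mul_t_pow h]
  exact (Commute.sum_right _ _ _ fun i _ => (hc _).mul_right (ht.pow_right i)).eq.symm

/-- Left and right multiplication by `t` commute, and their difference acts on constants as `δ`;
this is the binomial theorem for their sum. -/
theorem t_pow_mul_const (a : D) (n : ℕ) : t δ ^ n * const δ a =
    ∑ i ∈ Finset.range (n + 1), const δ (n.choose i • δ^[n - i] a) * t δ ^ i := by
  let lt : Module.End ℤ (DiffPoly δ) := LinearMap.mulLeft ℤ (t δ)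
  let rt : Module.End ℤ (DiffPoly δ) := LinearMap.mulRight ℤ (t δ)
  have hlr : Commute lt rt := LinearMap.commute_mulLeft_right _ _
  have hcomm : Commute rt (lt - rt) := hlr.symm.sub_right (Commute.refl _)
  have had : ∀ k, ((lt - rt) ^ k) (const δ a) = const δ (δ^[k] a) := by
    intro k
    induction k with
    | zero => rfl
    | succ k ih =>
      rw [pow_succ', Module.End.mul_apply, ih, Function.iterate_succ_apply']
      change t δ * const δ _ - const δ _ * t δ = _
      rw [t_mul_const, add_sub_cancel_left]
  have h1 := LinearMap.congr_fun (hcomm.add_pow n) (const δ a)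
  rw [add_sub_cancel] at h1
  have h2 : (lt ^ n) (const δ a) = t δ ^ n * const δ a := by
    simp [lt, LinearMap.pow_mulLeft]
  rw [← h2, h1, LinearMap.sum_apply]
  refine Finset.sum_congr rfl fun i _ => ?_
  rw [Module.End.mul_apply, Module.End.mul_apply, Module.End.natCast_apply, map_nsmul, had,
    map_nsmul, map_nsmul]
  simp [rt, LinearMap.pow_mulRight, mul_assoc]

theorem t_pow_expChar_mul_const (p : ℕ) [Fact p.Prime] [CharP D p] (a : D) (k : ℕ) :
    t δ ^ p ^ k * const δ a = const δ a * t δ ^ p ^ k + const δ (δ^[p ^ k] a) := by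
  have hpos : 0 < p ^ k := pow_pos (Fact.out : p.Prime).pos k
  rw [t_pow_mul_const, Finset.sum_range_succ, Finset.sum_eq_single_of_mem 0 (by simpa using hpos)]
  · simp [add_comm]
  · intro i hi hi0
    have hdvd : p ∣ (p ^ k).choose i :=
      (Fact.out : p.Prime).dvd_choose_pow hi0 (by simpa using (Finset.mem_range.mp hi).ne)
    rw [nsmul_eq_mul, (CharP.cast_eq_zero_iff D p _).mpr hdvd, zero_mul, map_zero, zero_mul]

end Ring

/-! ### The central element `x`. -/

section CentralVariable

variable {D : Type u} [DivisionRing D] {δ : RingDerivation D}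

theorem evalAt_C_mul_X_pow (y : DiffPoly δ) (c : δ.centralConst) (n : ℕ) :
    evalAt δ y (C c * X ^ n) = const δ (algebraMap δ.centralConst D c) * y ^ n := by
  rw [evalAt, C_mul_X_pow_eq_monomial, eval₂_monomial]
  rfl

theorem evalAt_add (y : DiffPoly δ) (P Q : δ.centralConst[X]) :
    evalAt δ y (P + Q) = evalAt δ y P + evalAt δ y Q := eval₂_add _ _

theorem evalAt_sum (y : DiffPoly δ) {ι : Type*} (s : Finset ι) (P : ι → δ.centralConst[X]) :
    evalAt δ y (∑ i ∈ s, P i) = ∑ i ∈ s, evalAt δ y (P i) := eval₂_finsetSum _ _ _ _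

theorem toEnd_pow_apply (n : ℕ) (a : D) : (δ.toEnd ^ n) a = δ^[n] a := by
  induction n with
  | zero => rfl
  | succ n ih => rw [pow_succ', Function.iterate_succ_apply', ← ih]; rfl

theorem const_centralConst_commute (c : δ.centralConst) (a : D) :
    algebraMap δ.centralConst D c * a = a * algebraMap δ.centralConst D c :=
  Algebra.commutes c a

theorem const_commute_t {a : D} (ha : δ a = 0) : Commute (const δ a) (t δ) := by
  have := t_mul_const δ a
  rw [ha, map_zero, add_zero] at this
  exact this.symm

theorem monomial_mul_const (p : ℕ) [Fact p.Prime] [CharP D p] (c : δ.centralConst) (k : ℕ)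
    (a : D) : evalAt δ (t δ) (C c * X ^ p ^ k) * const δ a =
      const δ a * evalAt δ (t δ) (C c * X ^ p ^ k) +
        const δ (aeval δ.toEnd (C c * X ^ p ^ k) a) := by
  have h1 : aeval δ.toEnd (C c * X ^ p ^ k) a =
      algebraMap δ.centralConst D c * δ^[p ^ k] a := by
    rw [map_mul, map_pow, aeval_X, aeval_C, Module.End.mul_apply, toEnd_pow_apply]
    exact Algebra.smul_def c _
  rw [evalAt_C_mul_X_pow, h1, mul_assoc, t_pow_expChar_mul_const p, mul_add, ← mul_assoc,
    ← mul_assoc, ← map_mul, ← map_mul, ← map_mul, const_centralConst_commute]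

/-- In characteristic `p` the commutator of `t ^ p ^ k` with `a` is the constant `δ^[p ^ k] a`.
Hence that of `g(t)` is `g(δ)(a)`, which the commutator with `d₀` cancels. Commutation with `t`
holds because `d₀` and the coefficients of `g` are killed by `δ`. -/
theorem centralVar_mem_center (p : ℕ) [Fact p.Prime] [CharP D p] (e : ℕ) (c : ℕ → δ.centralConst)
    (g : δ.centralConst[X])
    (hg : g = X ^ p ^ e + ∑ i ∈ Finset.Icc 1 e, C (c i) * X ^ p ^ (e - i))
    (d₀ : D) (hd₀ : ∀ a : D, (aeval δ.toEnd g) a = d₀ * a - a * d₀) (hδd₀ : δ d₀ = 0) :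
    centralVar δ g d₀ ∈ Subring.center (DiffPoly δ) := by
  have hga : ∀ a, evalAt δ (t δ) g * const δ a =
      const δ a * evalAt δ (t δ) g + const δ (aeval δ.toEnd g a) := by
    intro a
    have h1 := monomial_mul_const (δ := δ) p 1 e a
    rw [C_1, one_mul] at h1
    rw [hg, evalAt_add, evalAt_sum, map_add, LinearMap.add_apply, map_add, add_mul, h1, mul_add,
      Finset.sum_mul, Finset.mul_sum, map_sum, LinearMap.sum_apply, map_sum,
      Finset.sum_congr rfl fun i _ => monomial_mul_const p (c i) (e - i) a,
      Finset.sum_add_distrib]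
    abel
  refine mem_center_of_commute (fun a => ?_) ?_
  · change (_ - _) * _ = _ * (_ - _)
    rw [sub_mul, hga, hd₀, mul_sub, map_sub, map_mul, map_mul]
    abel
  · refine Commute.sub_left ?_ (const_commute_t hδd₀)
    rw [evalAt, eval₂_eq_sum_range]
    refine Commute.sum_left _ _ _ fun i _ => Commute.mul_left ?_ ((Commute.refl _).pow_left i)
    exact const_commute_t (g.coeff i).2

theorem hasLead_centralVar {g : δ.centralConst[X]} (hg : g.Monic) (hdeg : 0 < g.natDegree)
    (d₀ : D) : HasLead (centralVar δ g d₀) g.natDegree 1 := by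
  have h1 : toPoly δ (evalAt δ (t δ) g) = g.map (algebraMap δ.centralConst D) := by
    rw [evalAt, eval₂_eq_sum_range, map_sum]
    conv_rhs => rw [g.as_sum_range, Polynomial.map_sum]
    refine Finset.sum_congr rfl fun i _ => ?_
    rw [RingHom.comp_apply, const_mul_t_pow, AddEquiv.apply_symm_apply, map_monomial]
  have h2 : toPoly δ (centralVar δ g d₀) = g.map (algebraMap δ.centralConst D) - C d₀ := by
    rw [centralVar, map_sub, h1]
    rfl
  constructor
  · rw [h2]
    refine (natDegree_sub_le _ _).trans ?_
    rw [natDegree_C]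
    exact max_le natDegree_map_le (Nat.zero_le _)
  · rw [h2, coeff_sub, coeff_map, hg.coeff_natDegree, map_one, coeff_C_of_ne_zero hdeg.ne',
      sub_zero]

end CentralVariable

/-! ### `R` as a free left module over `D[x]`. -/

section Expansion

variable {D : Type u} [Ring D] {δ : RingDerivation D} {x : DiffPoly δ}

/-- Evaluation of polynomials with coefficients in `D` at a central element. -/
noncomputable def evalCenter (hx : x ∈ Subring.center (DiffPoly δ)) : D[X] →+* DiffPoly δ :=
  eval₂RingHom' (const δ) x fun _ => Subring.mem_center_iff.mp hx _

theorem evalCenter_C (hx : x ∈ Subring.center (DiffPoly δ)) (a : D) :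
    evalCenter hx (C a) = const δ a := eval₂_C _ _

theorem evalCenter_X (hx : x ∈ Subring.center (DiffPoly δ)) : evalCenter hx X = x := eval₂_X _ _

theorem evalCenter_monomial (hx : x ∈ Subring.center (DiffPoly δ)) (n : ℕ) (a : D) :
    evalCenter hx (monomial n a) = const δ a * x ^ n := eval₂_monomial _ _

theorem hasLead_evalCenter_monomial_mul (hx : x ∈ Subring.center (DiffPoly δ)) {N : ℕ}
    (hlead : HasLead x N 1) (q r : ℕ) (a : D) :
    HasLead (evalCenter hx (monomial q a) * t δ ^ r) (N * q + r) a := by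
  have := ((hasLead_const (δ := δ) a).mul (hlead.pow q)).mul (hasLead_t_pow r)
  rwa [mul_one, mul_one, zero_add, ← evalCenter_monomial hx] at this

/-- Division by `x`: the top term `a t^l` is traded for `a x^(l / N) t^(l % N)`, which has the same
leading term. The bound `l` is strict, and the last two clauses follow the coefficients of weight `N
q + r` at least `l` and exactly `l - 1`, as the leading coefficient of the norm requires. -/
theorem exists_expansion (hx : x ∈ Subring.center (DiffPoly δ)) {N : ℕ} (hN : 0 < N)
    (hlead : HasLead x N 1) (l : ℕ) (h : DiffPoly δ) (hl : ∀ k, l ≤ k → (toPoly δ h).coeff k = 0) :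
    ∃ H : Fin N → D[X], h = ∑ r, evalCenter hx (H r) * t δ ^ (r : ℕ) ∧
      ∀ (r : Fin N) (q : ℕ), (l ≤ N * q + r → (H r).coeff q = 0) ∧
        (N * q + r + 1 = l → (H r).coeff q = (toPoly δ h).coeff (N * q + r)) := by
  induction l generalizing h with
  | zero =>
    refine ⟨0, ?_, fun r q => ⟨fun _ => rfl, fun h => by omega⟩⟩
    simp only [Pi.zero_apply, map_zero, zero_mul, Finset.sum_const_zero]
    apply (toPoly δ).injective
    ext k
    rw [hl k (Nat.zero_le k), map_zero, coeff_zero]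
  | succ l ih =>
    set a := (toPoly δ h).coeff l with ha
    let r₀ : Fin N := ⟨l % N, Nat.mod_lt l hN⟩
    have hl0 : N * (l / N) + l % N = l := Nat.div_add_mod l N
    have hlead' := hasLead_evalCenter_monomial_mul hx hlead (l / N) (l % N) a
    rw [hl0] at hlead'
    obtain ⟨H, hH, hHc⟩ := ih (h - evalCenter hx (monomial (l / N) a) * t δ ^ (l % N)) (by
      intro k hk
      rw [map_sub, coeff_sub]
      rcases hk.eq_or_lt with rfl | hk
      · rw [hlead'.2, sub_self]
      · rw [hl k hk, hlead'.coeff_of_lt hk, sub_zero])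
    refine ⟨H + Pi.single r₀ (monomial (l / N) a), ?_, ?_⟩
    · simp only [Pi.add_apply, map_add, add_mul, Finset.sum_add_distrib]
      rw [← hH, Finset.sum_eq_single r₀]
      · simp [r₀]
      · intro r _ hr
        simp [Pi.single_eq_of_ne hr]
      · intro h; exact absurd (Finset.mem_univ _) h
    · have huniq : ∀ (r : Fin N) (q : ℕ), N * q + r = l → r = r₀ ∧ q = l / N := by
        intro r q hrq
        constructor
        · apply Fin.ext
          change (r : ℕ) = l % N
          rw [← hrq, Nat.mul_add_mod, Nat.mod_eq_of_lt r.2]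
        · rw [← hrq, Nat.mul_add_div hN, Nat.div_eq_of_lt r.2, add_zero]
      intro r q
      constructor
      · intro hrq
        rw [Pi.add_apply, coeff_add, (hHc r q).1 (by omega), zero_add]
        by_cases hr : r = r₀
        · rw [hr, Pi.single_eq_same, coeff_monomial, if_neg]
          rintro rfl
          have : (r : ℕ) = l % N := by rw [hr]
          omega
        · rw [Pi.single_eq_of_ne hr, coeff_zero]
      · intro hrq
        have hrq' : N * q + r = l := by omega
        obtain ⟨hr, hq⟩ := huniq r q hrq'
        rw [Pi.add_apply, coeff_add, (hHc r q).1 (by omega), zero_add, hrq', hr,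
          Pi.single_eq_same, hq, coeff_monomial_same]

/-- The elements `x^q t^r` with `r < N` have pairwise distinct degrees `N q + r` in `t`, so the
coefficient of greatest weight cannot cancel; one descends from a bound `B`. -/
theorem expansion_unique (hx : x ∈ Subring.center (DiffPoly δ)) {N : ℕ} (hN : 0 < N)
    (hlead : HasLead x N 1) (H : Fin N → D[X])
    (hH : ∑ r, evalCenter hx (H r) * t δ ^ (r : ℕ) = 0) : H = 0 := by
  have hstep : ∀ l, (∀ (r : Fin N) (q : ℕ), l < N * q + r → (H r).coeff q = 0) →
      ∀ (r : Fin N) (q : ℕ), l ≤ N * q + r → (H r).coeff q = 0 := by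
    intro l hl r q hrq
    rcases hrq.lt_or_eq with hrq | rfl
    · exact hl r q hrq
    have hterm : ∀ (r' : Fin N) (q' : ℕ), (toPoly δ (evalCenter hx
        (monomial q' ((H r').coeff q')) * t δ ^ (r' : ℕ))).coeff (N * q + r) =
        if N * q' + r' = N * q + r then (H r').coeff q' else 0 := by
      intro r' q'
      have h1 := hasLead_evalCenter_monomial_mul hx hlead q' r' ((H r').coeff q')
      rcases lt_trichotomy (N * q' + r') (N * q + r) with hlt | heq | hgt
      · rw [if_neg hlt.ne, h1.coeff_of_lt hlt]
      · rw [if_pos heq, ← heq, h1.2]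
      · rw [if_neg hgt.ne', hl r' q' hgt, map_zero, map_zero, zero_mul, map_zero, coeff_zero]
    have h2 := congrArg (fun y => (toPoly δ y).coeff (N * q + r)) hH
    have h3 : ∀ r' : Fin N, (toPoly δ (evalCenter hx (H r') * t δ ^ (r' : ℕ))).coeff (N * q + r) =
        if r' = r then (H r).coeff q else 0 := by
      intro r'
      conv_lhs => rw [(H r').as_sum_support]
      rw [map_sum, Finset.sum_mul, map_sum, finsetSum_coeff,
        Finset.sum_congr rfl fun q' _ => hterm r' q']
      have huniq : ∀ q', N * q' + r' = N * q + r → r' = r ∧ q' = q := by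
        intro q' h
        have h4 := congrArg (· % N) h
        have h5 := congrArg (· / N) h
        simp only [Nat.mul_add_mod, Nat.mul_add_div hN, Nat.mod_eq_of_lt r'.2,
          Nat.mod_eq_of_lt r.2, Nat.div_eq_of_lt r'.2, Nat.div_eq_of_lt r.2, add_zero] at h4 h5
        exact ⟨Fin.ext h4, h5⟩
      split_ifs with hr
      · subst hr
        rw [Finset.sum_eq_single q]
        · rw [if_pos rfl]
        · intro q' _ hq'
          exact if_neg fun h => hq' (huniq q' h).2
        · intro hq'
          rw [if_pos rfl]
          exact notMem_support_iff.mp hq'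
      · exact Finset.sum_eq_zero fun q' _ => if_neg fun h => hr (huniq q' h).1
    simp only [map_sum, finsetSum_coeff, h3, map_zero, coeff_zero, Finset.sum_ite_eq',
      Finset.mem_univ, if_true] at h2
    exact h2
  obtain ⟨B, hB⟩ : ∃ B, ∀ (r : Fin N) (q : ℕ), B ≤ N * q + r → (H r).coeff q = 0 := by
    refine ⟨N * (∑ r, (H r).natDegree) + 2 * N, fun r q hrq => coeff_eq_zero_of_natDegree_lt ?_⟩
    have h1 : (H r).natDegree ≤ ∑ r, (H r).natDegree :=
      Finset.single_le_sum (f := fun r => (H r).natDegree) (fun _ _ => Nat.zero_le _)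
        (Finset.mem_univ r)
    have h2 := r.2
    by_contra hlt
    have h3 : N * q ≤ N * ∑ r, (H r).natDegree := Nat.mul_le_mul_left _ (by omega)
    omega
  have hall : ∀ l ≤ B, ∀ (r : Fin N) (q : ℕ), B - l ≤ N * q + r → (H r).coeff q = 0 := by
    intro l
    induction l with
    | zero => intro _; exact hB
    | succ l ih =>
      intro hl
      exact hstep _ fun r q hrq => ih (by omega) r q (by omega)
  funext r
  ext q
  exact hall B le_rfl r q (by omega)

theorem evalCenter_injective (hx : x ∈ Subring.center (DiffPoly δ)) {N : ℕ} (hN : 0 < N)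
    (hlead : HasLead x N 1) : Function.Injective (evalCenter hx) := by
  rw [injective_iff_map_eq_zero]
  intro P hP
  have h1 := expansion_unique hx hN hlead (Pi.single ⟨0, hN⟩ P) (by
    rw [Finset.sum_eq_single ⟨0, hN⟩]
    · simp [hP]
    · intro r _ hr
      simp [Pi.single_eq_of_ne hr]
    · intro h; exact absurd (Finset.mem_univ _) h)
  simpa using congrFun h1 ⟨0, hN⟩

end Expansion

end DiffPoly

/-! ### Leading coefficients of determinants of polynomial matrices -/

section PolynomialDet

variable {E : Type*} [CommRing E]

theorem natDegree_prod_le_and_coeff_prod {ι : Type*} (s : Finset ι) (f : ι → E[X]) (w : ι → ℕ)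
    (h : ∀ i ∈ s, (f i).natDegree ≤ w i) :
    (∏ i ∈ s, f i).natDegree ≤ ∑ i ∈ s, w i ∧
      (∏ i ∈ s, f i).coeff (∑ i ∈ s, w i) = ∏ i ∈ s, (f i).coeff (w i) := by
  classical
  induction s using Finset.induction_on with
  | empty => simp
  | insert i s hi ih =>
    obtain ⟨h1, h2⟩ := ih fun j hj => h j (Finset.mem_insert_of_mem hj)
    have h3 := h i (Finset.mem_insert_self _ _)
    rw [Finset.prod_insert hi, Finset.sum_insert hi, Finset.prod_insert hi]
    exact ⟨natDegree_mul_le_of_le h3 h1, by rw [coeff_mul_add_eq_of_natDegree_le h3 h1, h2]⟩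

theorem natDegree_det_le_and_coeff_det {ι : Type*} [Fintype ι] [DecidableEq ι]
    (M : Matrix ι ι E[X]) (w : ι → ℕ) (h : ∀ a b, (M a b).natDegree ≤ w a) :
    M.det.natDegree ≤ ∑ i, w i ∧
      M.det.coeff (∑ i, w i) = (Matrix.of fun a b => (M a b).coeff (w a)).det := by
  have hσ : ∀ σ : Equiv.Perm ι, ∑ i, w (σ i) = ∑ i, w i := fun σ => Equiv.sum_comp σ w
  have hp : ∀ σ : Equiv.Perm ι, _ := fun σ =>
    natDegree_prod_le_and_coeff_prod Finset.univ (fun i => M (σ i) i) (fun i => w (σ i))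
      fun i _ => h _ _
  simp only [hσ] at hp
  constructor
  · rw [Matrix.det_apply]
    exact natDegree_sum_le_of_forall_le _ _ fun σ _ => (natDegree_smul_le _ _).trans (hp σ).1
  · rw [Matrix.det_apply, Matrix.det_apply, finsetSum_coeff]
    refine Finset.sum_congr rfl fun σ _ => ?_
    rw [coeff_smul, (hp σ).2]
    rfl

open scoped Kronecker in
/-- The leading coefficient of the determinant of a matrix with entries of weighted degrees. -/
theorem det_coeff_of_weighted {d N : ℕ} [NeZero N] (m : ℕ) (W : Matrix (Fin d) (Fin d) E)
    (M : Matrix (Fin d × Fin N) (Fin d × Fin N) E[X])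
    (hM : ∀ a b q, (m + a.2 < N * q + b.2 → (M a b).coeff q = 0) ∧
      (N * q + b.2 = m + a.2 → (M a b).coeff q = W a.1 b.1)) :
    M.det.natDegree ≤ d * m ∧
      (M.det.coeff (d * m) = W.det ^ N ∨ M.det.coeff (d * m) = -W.det ^ N) := by
  have hN : 0 < N := Nat.pos_of_ne_zero (NeZero.ne N)
  set S : ℕ := ∑ b : Fin d × Fin N, (b.2 : ℕ) with hS
  -- Replacing `X` by `X ^ N` and scaling column `b` by `X ^ b.2` turns the weights into ordinary
  -- degrees, bounded by `m + a.2` along row `a`. The scaling shifts the determinant by `S`, which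
  -- the row bounds contribute as well.
  let M' : Matrix (Fin d × Fin N) (Fin d × Fin N) E[X] :=
    Matrix.of fun a b => X ^ (b.2 : ℕ) * (expand E N).mapMatrix M a b
  have hdet : M'.det = X ^ S * expand E N M.det := by
    rw [Matrix.det_mul_row, Finset.prod_pow_eq_pow_sum, AlgHom.map_det]
  have hcoeff : ∀ a b k, (M' a b).coeff k = if (b.2 : ℕ) ≤ k then
      if N ∣ k - b.2 then (M a b).coeff ((k - b.2) / N) else 0 else 0 := by
    intro a b k
    change (X ^ (b.2 : ℕ) * expand E N (M a b)).coeff k = _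
    rw [coeff_X_pow_mul', coeff_expand hN]
  have hdegM : ∀ a b, (M' a b).natDegree ≤ m + a.2 := by
    intro a b
    rw [natDegree_le_iff_coeff_eq_zero]
    intro k hk
    rw [hcoeff]
    split_ifs with h1 h2
    · apply (hM a b _).1
      rw [Nat.mul_div_cancel' h2]
      omega
    · rfl
    · rfl
  obtain ⟨h1, h2⟩ := natDegree_det_le_and_coeff_det M' (fun a => m + a.2) hdegM
  have hsum : ∑ a : Fin d × Fin N, (m + (a.2 : ℕ)) = N * (d * m) + S := by
    rw [Finset.sum_add_distrib, Finset.sum_const, Finset.card_univ, Fintype.card_prod,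
      Fintype.card_fin, Fintype.card_fin, smul_eq_mul]
    ring
  rw [hsum] at h1 h2
  have hc : ∀ q, M'.det.coeff (N * q + S) = M.det.coeff q := by
    intro q
    rw [hdet, coeff_X_pow_mul, coeff_expand_mul' hN]
  constructor
  · rw [natDegree_le_iff_coeff_eq_zero]
    intro q hq
    rw [← hc]
    apply coeff_eq_zero_of_natDegree_lt
    have : N * (d * m) < N * q := Nat.mul_lt_mul_of_pos_left hq hN
    omega
  -- Weight `m + a.2` is reached only in columns with `b.2` congruent to `m + a.2` modulo `N`, so
  -- the leading matrix is `W` tensored with the cyclic shift by `m`. The shift contributes only a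
  -- sign.
  · let σ : Equiv.Perm (Fin N) := Equiv.addLeft (Fin.ofNat N m)
    have hσ : ∀ i, ((σ i : Fin N) : ℕ) = (m + i) % N := by
      intro i
      simp [σ, Fin.val_add, Fin.ofNat]
    have hT : (Matrix.of fun a b => (M' a b).coeff (m + a.2)) =
        W ⊗ₖ (σ.permMatrix E) := by
      ext a b
      rw [Matrix.of_apply, hcoeff, Matrix.kronecker_apply, Equiv.Perm.permMatrix,
        PEquiv.toMatrix_apply]
      have hb := b.2.2
      have hiff : b.2 ∈ σ.toPEquiv a.2 ↔ (m + (a.2 : ℕ)) % N = b.2 := by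
        rw [Equiv.toPEquiv_apply, Option.mem_some_iff, ← hσ, Fin.ext_iff]
      by_cases hmod : (m + (a.2 : ℕ)) % N = b.2
      · have h3 := Nat.div_add_mod (m + (a.2 : ℕ)) N
        rw [hmod] at h3
        have h4 : m + (a.2 : ℕ) - b.2 = N * ((m + (a.2 : ℕ)) / N) := by omega
        rw [if_pos (by omega), if_pos (by rw [h4]; exact dvd_mul_right _ _),
          if_pos (hiff.mpr hmod), mul_one]
        apply (hM a b _).2
        rw [h4, Nat.mul_div_cancel_left _ hN]
        exact h3
      · rw [if_neg (fun h => hmod (hiff.mp h)), mul_zero]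
        split_ifs with h3 h4
        · exfalso
          obtain ⟨q, hq⟩ := h4
          apply hmod
          rw [show m + (a.2 : ℕ) = N * q + b.2 by omega, Nat.mul_add_mod, Nat.mod_eq_of_lt hb]
        · rfl
        · rfl
    rw [hc, hT, Matrix.det_kronecker, Matrix.det_permutation, Fintype.card_fin,
      Fintype.card_fin] at h2
    rw [h2]
    rcases Int.units_eq_one_or (Equiv.Perm.sign σ) with h3 | h3
    · left; simp [h3]
    · rcases neg_one_pow_eq_or E d with h4 | h4
      · left; simp [h3, h4]
      · right; simp [h3, h4]

end PolynomialDet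

/-! ### Centralizers and central elements inside `D[x]`. -/

namespace DiffPoly

section Centralizer

variable {D : Type u} [DivisionRing D] {δ : RingDerivation D} {x : DiffPoly δ}

theorem t_pow_mul_const_fin {N : ℕ} (a : D) (r : Fin N) : t δ ^ (r : ℕ) * const δ a =
    ∑ i : Fin N, const δ ((r : ℕ).choose i • δ^[(r : ℕ) - i] a) * t δ ^ (i : ℕ) := by
  rw [t_pow_mul_const, ← Finset.sum_range fun i =>
    const δ ((r : ℕ).choose i • δ^[(r : ℕ) - i] a) * t δ ^ i]
  apply Finset.sum_subset
  · intro i hi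
    have := r.2
    simp only [Finset.mem_range] at hi ⊢
    omega
  · intro i _ hi
    rw [Nat.choose_eq_zero_of_lt (by simpa using hi), zero_smul, map_zero, zero_mul]

/-- Commute `f = Σ H_r(x) t^r` with `c` in `C` and compare the coefficients of `t^0`: this is a
relation between the `δ^[r] c`, whose independence kills every `H_r` with `r > 0`. Commuting with
`E` then puts the coefficients of `H_0` in `E`. -/
theorem exists_eq_evalCenter_of_commute (hx : x ∈ Subring.center (DiffPoly δ)) {N : ℕ} (hN : 0 < N)
    (hlead : HasLead x N 1) (hmin : N ≤ (minpoly δ.centralConst δ.centerEnd).natDegree)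
    (E : Subalgebra (Subring.center D) D) (hE : ∀ z, (∀ e ∈ E, z * e = e * z) → z ∈ E)
    (f : DiffPoly δ) (hf : ∀ e ∈ E, f * const δ e = const δ e * f) :
    ∃ Q : D[X], (∀ q, Q.coeff q ∈ E) ∧ f = evalCenter hx Q := by
  obtain ⟨H, hH, -⟩ := exists_expansion hx hN hlead ((toPoly δ f).natDegree + 1) f
    fun k hk => coeff_eq_zero_of_natDegree_lt hk
  let z : Fin N := ⟨0, hN⟩
  have hrel : ∀ c ∈ Subring.center D, ∀ q,
      ∑ r : Fin N, (H r).coeff q * δ^[(r : ℕ)] c = (H z).coeff q * c := by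
    intro c hc q
    have h1 := hf c (E.algebraMap_mem ⟨c, hc⟩)
    have h2 : f * const δ c = ∑ i : Fin N, evalCenter hx
        (∑ r : Fin N, H r * C ((r : ℕ).choose i • δ^[(r : ℕ) - i] c)) * t δ ^ (i : ℕ) := by
      conv_lhs => rw [hH]
      simp only [map_sum, map_mul, evalCenter_C, Finset.sum_mul]
      rw [Finset.sum_comm]
      refine Finset.sum_congr rfl fun r _ => ?_
      rw [mul_assoc, t_pow_mul_const_fin, Finset.mul_sum]
      simp only [mul_assoc]
    have h3 : const δ c * f = ∑ i : Fin N, evalCenter hx (C c * H i) * t δ ^ (i : ℕ) := by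
      conv_lhs => rw [hH]
      simp only [map_mul, evalCenter_C, Finset.mul_sum, mul_assoc]
    rw [h2, h3, ← sub_eq_zero, ← Finset.sum_sub_distrib] at h1
    simp only [← sub_mul, ← map_sub] at h1
    have h4 := congrArg (fun P => P.coeff q) (congrFun (expansion_unique hx hN hlead
      (fun i => (∑ r : Fin N, H r * C ((r : ℕ).choose i • δ^[(r : ℕ) - i] c)) - C c * H i) h1) z)
    simp only [z, Nat.choose_zero_right, one_smul, Nat.sub_zero, coeff_sub, finsetSum_coeff,
      coeff_mul_C, coeff_C_mul, Pi.zero_apply, coeff_zero] at h4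
    rw [sub_eq_zero.mp h4, Subring.mem_center_iff.mp hc]
  have hzero : ∀ r : Fin N, r ≠ z → H r = 0 := by
    intro r hr
    ext q
    let k : ℕ → D := fun r => if hr : r < N then (H ⟨r, hr⟩).coeff q else 0
    have h1 := δ.eq_zero_of_forall_sum_iterate_eq_zero N hmin
      -- The term `H_0 c` occurs on both sides of `hrel`, so the coefficient at `r = 0` is
      -- cancelled.
      (fun r => k r - if r = 0 then k 0 else 0) (by
        intro c hc
        simp only [sub_mul, Finset.sum_sub_distrib, ite_mul, zero_mul, Finset.sum_ite_eq',
          Finset.mem_range.mpr hN, if_true]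
        rw [Finset.sum_range, sub_eq_zero]
        have := hrel c hc q
        simpa [k, hN, z] using this) r r.2
    have hr0 : (r : ℕ) ≠ 0 := fun h => hr (Fin.ext h)
    simpa [k, hr0] using h1
  have hfz : f = evalCenter hx (H z) := by
    rw [hH, Finset.sum_eq_single z]
    · simp [z]
    · intro r _ hr
      rw [hzero r hr, map_zero, zero_mul]
    · intro h; exact absurd (Finset.mem_univ _) h
  refine ⟨H z, fun q => hE _ fun e he => ?_, hfz⟩
  have h1 := hf e he
  rw [hfz, ← evalCenter_C hx, ← map_mul, ← map_mul] at h1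
  have h2 := congrArg (fun P => P.coeff q) (evalCenter_injective hx hN hlead h1)
  simpa using h2

theorem t_mul_evalCenter (hx : x ∈ Subring.center (DiffPoly δ)) (Q : D[X]) :
    t δ * evalCenter hx Q = evalCenter hx Q * t δ + evalCenter hx (coeffDer δ Q) := by
  induction Q using Polynomial.induction_on' with
  | add p q hp hq => rw [map_add, map_add, map_add, mul_add, hp, hq, add_mul]; abel
  | monomial n a =>
    rw [coeffDer_monomial, evalCenter_monomial, evalCenter_monomial, ← mul_assoc, t_mul_const,
      add_mul, mul_assoc, mul_assoc, Subring.mem_center_iff.mp (pow_mem hx n) (t δ)]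

/-- Commuting with `D` makes the coefficients central, and commuting with `t` makes them constants.
-/
theorem exists_map_eq_of_evalCenter_mem_center (hx : x ∈ Subring.center (DiffPoly δ)) {N : ℕ}
    (hN : 0 < N) (hlead : HasLead x N 1) (Q : D[X])
    (hQ : evalCenter hx Q ∈ Subring.center (DiffPoly δ)) :
    ∃ P : δ.centralConst[X], P.map (algebraMap δ.centralConst D) = Q := by
  rw [Subring.mem_center_iff] at hQ
  have hinj := evalCenter_injective hx hN hlead
  have h1 : ∀ q, Q.coeff q ∈ Subring.center D := by
    intro q
    rw [Subring.mem_center_iff]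
    intro a
    have h := hQ (const δ a)
    rw [← evalCenter_C hx, ← map_mul, ← map_mul] at h
    simpa using congrArg (fun P => P.coeff q) (hinj h)
  have h2 : ∀ q, δ (Q.coeff q) = 0 := by
    intro q
    have h := hQ (t δ)
    rw [t_mul_evalCenter, add_eq_left, ← map_zero (evalCenter hx)] at h
    rw [← coeff_coeffDer, hinj h, coeff_zero]
  have h3 : Q ∈ Polynomial.lifts (algebraMap δ.centralConst D) := by
    rw [Polynomial.lifts_iff_coeff_lifts]
    intro q
    exact ⟨⟨⟨Q.coeff q, h1 q⟩, h2 q⟩, rfl⟩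
  exact (Polynomial.mem_lifts Q).mp h3

theorem evalAt_eq_evalCenter (hx : x ∈ Subring.center (DiffPoly δ)) (P : δ.centralConst[X]) :
    evalAt δ x P = evalCenter hx (P.map (algebraMap δ.centralConst D)) :=
  (eval₂_map _ _ _).symm

theorem evalAt_mem_center (hx : x ∈ Subring.center (DiffPoly δ)) (P : δ.centralConst[X]) :
    evalAt δ x P ∈ Subring.center (DiffPoly δ) := by
  rw [evalAt, eval₂_eq_sum_range]
  refine sum_mem fun i _ => mul_mem ?_ (pow_mem hx i)
  refine mem_center_of_commute (fun a => ?_) (const_commute_t (P.coeff i).2)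
  change const δ _ * const δ a = const δ a * const δ _
  rw [← map_mul, ← map_mul]
  exact congrArg _ (const_centralConst_commute _ _)

end Centralizer

/-! ### Right multiplication on the elements `v_k t^r`. -/

section RegularRepresentation

variable {D : Type u} [DivisionRing D] {δ : RingDerivation D} {x : DiffPoly δ}
  {E : Subalgebra (Subring.center D) D} {d : ℕ} (v : Module.Basis (Fin d) E D)

/-- The coordinates of a polynomial over `D` with respect to a basis of `D` over `E`. -/
noncomputable def coordPoly (H : D[X]) (k : Fin d) : E[X] :=
  ∑ q ∈ Finset.range (H.natDegree + 1), monomial q (v.repr (H.coeff q) k)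

theorem coeff_coordPoly (H : D[X]) (k : Fin d) (q : ℕ) :
    (coordPoly v H k).coeff q = v.repr (H.coeff q) k := by
  simp only [coordPoly, finsetSum_coeff, coeff_monomial]
  rw [Finset.sum_ite_eq']
  split_ifs with h
  · rfl
  · rw [coeff_eq_zero_of_natDegree_lt (by simpa using h), map_zero, Finsupp.zero_apply]

theorem sum_coordPoly (H : D[X]) :
    ∑ k, (coordPoly v H k).map (E.val : E →+* D) * C (v k) = H := by
  ext q
  rw [finsetSum_coeff]
  conv_rhs => rw [← v.sum_repr (H.coeff q)]
  refine Finset.sum_congr rfl fun k _ => ?_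
  rw [coeff_mul_C, coeff_map, coeff_coordPoly]
  rfl

variable (δ) in
/-- The elements `vₖ tʳ`. -/
noncomputable def basisVec (N : ℕ) (b : Fin d × Fin N) : DiffPoly δ :=
  const δ (v b.1) * t δ ^ (b.2 : ℕ)

variable [IsMulCommutative E]

/-- Evaluation at a central element of polynomials with coefficients in a subalgebra. -/
noncomputable def evalSub (hx : x ∈ Subring.center (DiffPoly δ))
    (E : Subalgebra (Subring.center D) D) [IsMulCommutative E] : E[X] →+* DiffPoly δ :=
  (evalCenter hx).comp (mapRingHom (E.val : E →+* D))

theorem evalSub_apply (hx : x ∈ Subring.center (DiffPoly δ)) (Q : E[X]) :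
    evalSub hx E Q = evalCenter hx (Q.map (E.val : E →+* D)) := rfl

theorem exists_coordinates (hx : x ∈ Subring.center (DiffPoly δ)) {N : ℕ} (hN : 0 < N)
    (hlead : HasLead x N 1) {h : DiffPoly δ} {l : ℕ} {a : D} (hl : HasLead h l a) :
    ∃ Q : Fin d × Fin N → E[X], h = ∑ b, evalSub hx E (Q b) * basisVec δ v N b ∧
      ∀ b q, (l < N * q + b.2 → (Q b).coeff q = 0) ∧
        (N * q + b.2 = l → (Q b).coeff q = v.repr a b.1) := by
  obtain ⟨H, hH, hHc⟩ := exists_expansion hx hN hlead (l + 1) h fun k hk => hl.coeff_of_lt hk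
  refine ⟨fun b => coordPoly v (H b.2) b.1, ?_, fun b q => ⟨fun hq => ?_, fun hq => ?_⟩⟩
  · rw [hH, Fintype.sum_prod_type_right]
    refine Finset.sum_congr rfl fun r _ => ?_
    conv_lhs => rw [← sum_coordPoly v (H r)]
    rw [map_sum, Finset.sum_mul]
    refine Finset.sum_congr rfl fun k _ => ?_
    rw [map_mul, evalCenter_C, evalSub_apply, basisVec, mul_assoc]
  · rw [coeff_coordPoly, (hHc b.2 q).1 hq, map_zero, Finsupp.zero_apply]
  · rw [coeff_coordPoly, (hHc b.2 q).2 (by omega), hq, hl.2]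

theorem coordinates_unique (hx : x ∈ Subring.center (DiffPoly δ)) {N : ℕ} (hN : 0 < N)
    (hlead : HasLead x N 1) (Q : Fin d × Fin N → E[X])
    (hQ : ∑ b, evalSub hx E (Q b) * basisVec δ v N b = 0) : Q = 0 := by
  have h1 := expansion_unique hx hN hlead
    (fun r => ∑ k, (Q (k, r)).map (E.val : E →+* D) * C (v k)) (by
      rw [← hQ, Fintype.sum_prod_type_right]
      refine Finset.sum_congr rfl fun r _ => ?_
      rw [map_sum, Finset.sum_mul]
      refine Finset.sum_congr rfl fun k _ => ?_
      rw [map_mul, evalCenter_C, evalSub_apply, basisVec, mul_assoc])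
  funext b
  ext q : 1
  have h2 : ∑ k, (Q (k, b.2)).coeff q • v k = 0 := by
    have := congrArg (fun P => P.coeff q) (congrFun h1 b.2)
    simp only [finsetSum_coeff, coeff_mul_C, coeff_map, Pi.zero_apply, coeff_zero] at this
    exact this
  exact Fintype.linearIndependent_iff.mp v.linearIndependent _ h2 b.1

/-- The leading term of `v_k t^r f` is `v_k a t^(m + r)`, and the coordinates of `v_k a` are row `k`
of the regular representation of `a`. -/
theorem exists_matrix (hx : x ∈ Subring.center (DiffPoly δ)) {N : ℕ} (hN : 0 < N)
    (hlead : HasLead x N 1) {f : DiffPoly δ} {m : ℕ} {a : D} (hf : HasLead f m a) :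
    ∃ M : Matrix (Fin d × Fin N) (Fin d × Fin N) E[X],
      (∀ i, basisVec δ v N i * f = ∑ b, evalSub hx E (M i b) * basisVec δ v N b) ∧
      ∀ i b q, (m + i.2 < N * q + b.2 → (M i b).coeff q = 0) ∧
        (N * q + b.2 = m + i.2 → (M i b).coeff q = regMatrix v a i.1 b.1) := by
  have h : ∀ i : Fin d × Fin N, HasLead (basisVec δ v N i * f) (m + i.2) (v i.1 * a) := by
    intro i
    have := ((hasLead_const (δ := δ) (v i.1)).mul (hasLead_t_pow (i.2 : ℕ))).mul hf
    rwa [mul_one, zero_add, add_comm] at this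
  choose Q hQ hQc using fun i => exists_coordinates v hx hN hlead (h i)
  exact ⟨Matrix.of Q, hQ, hQc⟩

theorem det_regMatrix_ne_zero {a : D} (ha : a ≠ 0) : (regMatrix v a).det ≠ 0 := by
  have h1 : regMatrix v a * regMatrix v a⁻¹ = 1 := by
    rw [← map_mul, mul_inv_cancel₀ ha, map_one]
  have h2 := congrArg Matrix.det h1
  rw [Matrix.det_mul, Matrix.det_one] at h2
  intro h0
  rw [h0, zero_mul] at h2
  exact zero_ne_one h2

end RegularRepresentation

/-! ### Nonzero central left multiples. -/

section LeftMultiples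

variable {D : Type u} [DivisionRing D] {δ : RingDerivation D} {x : DiffPoly δ}

/-- The power rule holds for central elements, so `c ^ p` is a constant. -/
theorem isAlgebraic_center (p : ℕ) [Fact p.Prime] [CharP D p] :
    Algebra.IsAlgebraic δ.centralConst (Subring.center D) := by
  have hp : p.Prime := Fact.out
  refine ⟨fun c => ?_⟩
  have hpow : ∀ n : ℕ, δ ((c : D) ^ (n + 1)) = (n + 1 : ℕ) * (c : D) ^ n * δ (c : D) := by
    intro n
    induction n with
    | zero => simp
    | succ n ih =>
      rw [pow_succ (c : D) (n + 1), δ.leibniz, ih, Nat.cast_succ (n + 1), mul_assoc _ _ (c : D),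
        Subring.mem_center_iff.mp c.2 (δ (c : D)), ← mul_assoc _ (c : D) (δ (c : D)),
        mul_assoc _ ((c : D) ^ n) (c : D), ← pow_succ]
      rw [add_mul, add_mul, one_mul, add_comm]
  have hcp : δ ((c : D) ^ p) = 0 := by
    obtain ⟨n, rfl⟩ : ∃ n, p = n + 1 := ⟨p - 1, (Nat.succ_pred_prime hp).symm⟩
    rw [hpow, CharP.cast_eq_zero, zero_mul, zero_mul]
  let k : δ.centralConst := ⟨c ^ p, hcp⟩
  have h1 : IsIntegral δ.centralConst (c ^ p) := isIntegral_algebraMap (x := k)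
  exact (IsIntegral.of_pow hp.pos h1).isAlgebraic

theorem exists_map_eq_mul (p : ℕ) [Fact p.Prime] [CharP D p]
    [Module.Finite (Subring.center D) D] (E : Subalgebra (Subring.center D) D)
    [IsMulCommutative E] (Q : E[X]) (hQ : Q ≠ 0) :
    ∃ (P : δ.centralConst[X]) (Q' : E[X]), P ≠ 0 ∧
      P.map (algebraMap δ.centralConst E) = Q' * Q := by
  have := isAlgebraic_center (δ := δ) p
  have : Algebra.IsAlgebraic δ.centralConst E := Algebra.IsAlgebraic.trans _ (Subring.center D) _
  let _ := Polynomial.algebra δ.centralConst E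
  obtain ⟨P, hP, Q', hQ'⟩ := (Algebra.IsAlgebraic.isAlgebraic (R := δ.centralConst[X])
    Q).exists_nonzero_dvd (mem_nonZeroDivisors_of_ne_zero hQ)
  exact ⟨P, Q', hP, by rw [mul_comm]; exact hQ'⟩

/-- The determinant of right multiplication by `f` is nonzero by its leading coefficient. A row of
the adjugate gives a left multiple of `f` equal to `det · v_k`, and the determinant divides a
nonzero polynomial over `F` because `E` is algebraic over `F`. -/
theorem exists_mul_mem_center (p : ℕ) [Fact p.Prime] [CharP D p]
    [Module.Finite (Subring.center D) D]
    {E : Subalgebra (Subring.center D) D} [IsMulCommutative E] {d : ℕ}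
    (v : Module.Basis (Fin d) E D) (hx : x ∈ Subring.center (DiffPoly δ)) {N : ℕ} (hN : 0 < N)
    (hlead : HasLead x N 1) (f : DiffPoly δ) (hf : f ≠ 0) :
    ∃ y, y * f ∈ Subring.center (DiffPoly δ) ∧ y * f ≠ 0 := by
  have hfl : HasLead f (toPoly δ f).natDegree (toPoly δ f).leadingCoeff := ⟨le_rfl, rfl⟩
  have ha : (toPoly δ f).leadingCoeff ≠ 0 :=
    leadingCoeff_ne_zero.mpr ((toPoly δ).map_ne_zero_iff.mpr hf)
  obtain ⟨M, hM, hMc⟩ := exists_matrix v hx hN hlead hfl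
  have : NeZero N := ⟨hN.ne'⟩
  have hdet : M.det ≠ 0 := by
    intro h0
    have h1 := (det_coeff_of_weighted _ _ M hMc).2
    rw [h0, coeff_zero] at h1
    have h2 := pow_ne_zero N (det_regMatrix_ne_zero v ha)
    rcases h1 with h1 | h1
    · exact h2 h1.symm
    · exact h2 (neg_eq_zero.mp h1.symm)
  obtain ⟨k⟩ : Nonempty (Fin d) := v.index_nonempty
  -- Taking `t`-exponent `0` makes the basis element a constant, hence invertible.
  let b₀ : Fin d × Fin N := (k, ⟨0, hN⟩)
  have hb₀ : basisVec δ v N b₀ = const δ (v k) := by simp [basisVec, b₀]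
  obtain ⟨P, Q', hP, hPQ⟩ := exists_map_eq_mul (δ := δ) p E M.det hdet
  have h1 : (∑ a, evalSub hx E (M.adjugate b₀ a) * basisVec δ v N a) * f =
      evalSub hx E M.det * const δ (v k) := by
    rw [Finset.sum_mul]
    simp only [mul_assoc, hM, Finset.mul_sum]
    rw [Finset.sum_comm, ← hb₀]
    simp only [← mul_assoc, ← map_mul, ← Finset.sum_mul, ← map_sum]
    simp only [← Matrix.mul_apply, Matrix.adjugate_mul, Matrix.smul_apply, Matrix.one_apply,
      smul_eq_mul, mul_ite, mul_one, mul_zero]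
    rw [Finset.sum_eq_single b₀]
    · rw [if_pos rfl]
    · intro b _ hb
      rw [if_neg hb.symm, map_zero, zero_mul]
    · intro h; exact absurd (Finset.mem_univ _) h
  have h2 : evalSub hx E (P.map (algebraMap δ.centralConst E)) = evalAt δ x P := by
    rw [evalSub_apply, map_map, evalAt_eq_evalCenter hx]
    rfl
  have h3 : (const δ (v k)⁻¹ * evalSub hx E Q' *
      ∑ a, evalSub hx E (M.adjugate b₀ a) * basisVec δ v N a) * f = evalAt δ x P := by
    rw [mul_assoc, h1, mul_assoc, ← mul_assoc (evalSub hx E Q'), ← map_mul, ← hPQ, h2,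
      ← Subring.mem_center_iff.mp (evalAt_mem_center hx P), ← mul_assoc, ← map_mul,
      inv_mul_cancel₀ (v.ne_zero k), map_one, one_mul]
  refine ⟨_, by rw [h3]; exact evalAt_mem_center hx P, ?_⟩
  rw [h3, evalAt_eq_evalCenter hx, ← map_zero (evalCenter hx)]
  intro h0
  have h4 := evalCenter_injective hx hN hlead h0
  exact hP ((Polynomial.map_eq_zero _).mp h4)

end LeftMultiples

end DiffPoly

/-! ### Central quotients of a domain -/

namespace CentralQuotients

variable {R : Type u} [Ring R]

theorem of_eq_mk (r : R) : of R r = LocalizedModule.mk r 1 := rfl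

theorem algebraMap_algebraMap (z : Subring.center R) :
    algebraMap (FractionRing (Subring.center R)) (CentralQuotients R)
      (algebraMap (Subring.center R) (FractionRing (Subring.center R)) z) = of R z := by
  have h := LocalizedModule.algebraMap_mk' (T := FractionRing (Subring.center R))
    (S := nonZeroDivisors (Subring.center R)) (A := R) z 1
  rw [IsLocalization.mk'_one] at h
  exact h

theorem of_coe_commute (z : Subring.center R) (a : CentralQuotients R) :
    of R (z : R) * a = a * of R (z : R) := by
  rw [← algebraMap_algebraMap]
  exact Algebra.commutes _ _

variable [IsDomain R]

theorem of_injective : Function.Injective (of R) := by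
  intro r r' h
  obtain ⟨u, hu⟩ := LocalizedModule.mk_eq.mp h
  simp only [one_smul] at hu
  have hu' : ((u : Subring.center R) : R) * r = ((u : Subring.center R) : R) * r' := hu
  refine mul_left_cancel₀ ?_ hu'
  intro h0
  exact nonZeroDivisors.ne_zero u.2 (Subtype.ext h0)

theorem exists_of_mul_eq (a : CentralQuotients R) :
    ∃ (z : Subring.center R) (r : R), z ≠ 0 ∧ of R z * a = of R r := by
  induction a using LocalizedModule.induction_on with
  | h r s =>
    refine ⟨s, r, nonZeroDivisors.ne_zero s.2, ?_⟩
    rw [of_eq_mk, of_eq_mk]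
    refine (LocalizedModule.mk_mul_mk).trans ?_
    rw [one_mul]
    exact LocalizedModule.mk_cancel s r

theorem isUnit_of_coe {z : Subring.center R} (hz : z ≠ 0) : IsUnit (of R (z : R)) := by
  rw [← algebraMap_algebraMap]
  refine IsUnit.map _ (IsUnit.mk0 _ ?_)
  rwa [Ne, FaithfulSMul.algebraMap_eq_zero_iff]

instance : Nontrivial (CentralQuotients R) := (of_injective (R := R)).nontrivial

theorem exists_common_denominator {ι : Type*} [Fintype ι] (a : ι → CentralQuotients R) :
    ∃ z : Subring.center R, z ≠ 0 ∧ ∀ i, ∃ r, of R z * a i = of R r := by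
  classical
  choose z r hz hr using fun i => exists_of_mul_eq (a i)
  refine ⟨∏ i, z i, Finset.prod_ne_zero_iff.mpr fun i _ => hz i, fun i => ?_⟩
  refine ⟨(∏ j ∈ Finset.univ.erase i, z j : Subring.center R) * r i, ?_⟩
  rw [← Finset.prod_erase_mul _ _ (Finset.mem_univ i), Subring.coe_mul, map_mul, mul_assoc, hr,
    map_mul]

/-- Central left multiples give left inverses of all nonzero elements, and these are then two-sided.
-/
theorem isUnit_of_ne_zero (hR : ∀ f : R, f ≠ 0 → ∃ y, y * f ∈ Subring.center R ∧ y * f ≠ 0)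
    (a : CentralQuotients R) (ha : a ≠ 0) : IsUnit a := by
  have hleft : ∀ b : CentralQuotients R, b ≠ 0 → ∃ c, c * b = 1 := by
    intro b hb
    obtain ⟨z, r, hz, hr⟩ := exists_of_mul_eq b
    have hr0 : r ≠ 0 := by
      rintro rfl
      rw [map_zero, (isUnit_of_coe hz).mul_right_eq_zero] at hr
      exact hb hr
    obtain ⟨y, hy, hy0⟩ := hR r hr0
    obtain ⟨w, hw⟩ := (isUnit_of_coe (z := ⟨y * r, hy⟩)
      fun h => hy0 (congrArg Subtype.val h)).exists_left_inv
    refine ⟨w * of R y * of R z, ?_⟩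
    rw [mul_assoc, hr, mul_assoc, ← map_mul]
    exact hw
  obtain ⟨c, hc⟩ := hleft a ha
  have hc0 : c ≠ 0 := by
    rintro rfl
    rw [zero_mul] at hc
    exact zero_ne_one hc
  obtain ⟨c', hc'⟩ := hleft c hc0
  have h1 : c' = a := by
    calc c' = c' * (c * a) := by rw [hc, mul_one]
      _ = a := by rw [← mul_assoc, hc', one_mul]
  exact ⟨⟨a, c, by rw [← h1, hc'], hc⟩, rfl⟩

instance : Algebra.IsCentral (FractionRing (Subring.center R)) (CentralQuotients R) where
  out := by
    intro a ha
    rw [Subalgebra.mem_center_iff] at ha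
    obtain ⟨z, r, hz, hr⟩ := exists_of_mul_eq a
    have hrc : r ∈ Subring.center R := by
      rw [Subring.mem_center_iff]
      intro g
      apply of_injective
      rw [map_mul, map_mul, ← hr, ← mul_assoc, ← of_coe_commute, mul_assoc, ha, mul_assoc]
    rw [Algebra.mem_bot]
    refine ⟨algebraMap _ _ (⟨r, hrc⟩ : Subring.center R) / algebraMap _ _ z, ?_⟩
    apply (isUnit_of_coe hz).mul_left_cancel
    rw [hr, ← algebraMap_algebraMap, ← map_mul, mul_div_cancel₀]
    · exact algebraMap_algebraMap _
    · rwa [Ne, FaithfulSMul.algebraMap_eq_zero_iff]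

end CentralQuotients

/-! ### The splitting of `D(t;δ)` by `E(x)` -/

namespace DiffPoly

open CentralQuotients

variable {D : Type u} [DivisionRing D] {δ : RingDerivation D} {x : DiffPoly δ}

/-- The centralizer in `D(t;δ)` of a subalgebra `E` of `D`. -/
noncomputable def centralizerQuot (δ : RingDerivation D) (E : Subalgebra (Subring.center D) D) :
    Subalgebra (FractionRing (Subring.center (DiffPoly δ))) (CentralQuotients (DiffPoly δ)) :=
  Subalgebra.centralizer _ (((of (DiffPoly δ)).comp (const δ)) '' E)

theorem mem_centralizerQuot {E : Subalgebra (Subring.center D) D}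
    {a : CentralQuotients (DiffPoly δ)} : a ∈ centralizerQuot δ E ↔
      ∀ e ∈ E, of (DiffPoly δ) (const δ e) * a = a * of (DiffPoly δ) (const δ e) := by
  rw [centralizerQuot, Subalgebra.mem_centralizer_iff]
  constructor
  · intro h e he
    exact h _ ⟨e, he, rfl⟩
  · rintro h _ ⟨e, he, rfl⟩
    exact h e he

section

variable {E : Subalgebra (Subring.center D) D} [IsMulCommutative E]

theorem of_evalSub_mem (hx : x ∈ Subring.center (DiffPoly δ)) (Q : E[X]) :
    of (DiffPoly δ) (evalSub hx E Q) ∈ centralizerQuot δ E := by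
  rw [mem_centralizerQuot]
  intro e he
  have : const δ e = evalSub hx E (C ⟨e, he⟩) := by
    rw [evalSub_apply, map_C, evalCenter_C]
    rfl
  rw [this, ← map_mul, ← map_mul, ← map_mul, ← map_mul, mul_comm]

/-- The embedding of `E[x]` into the centralizer of `E` in `D(t;δ)`. -/
noncomputable def evalQuot (hx : x ∈ Subring.center (DiffPoly δ))
    (E : Subalgebra (Subring.center D) D) [IsMulCommutative E] : E[X] →+* centralizerQuot δ E :=
  ((of (DiffPoly δ)).comp (evalSub hx E)).codRestrict (centralizerQuot δ E)
    fun Q => of_evalSub_mem hx Q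

variable (hx : x ∈ Subring.center (DiffPoly δ)) {N : ℕ} (hN : 0 < N) (hlead : HasLead x N 1)
  (hmin : N ≤ (minpoly δ.centralConst δ.centerEnd).natDegree)
  (hE : ∀ z, (∀ e ∈ E, z * e = e * z) → z ∈ E)

include hN hlead hmin hE in
-- After clearing central denominators, the numerators still commute with `E`, so they lie in
-- `E[x]`. Questions about the centralizer thereby reduce to polynomials.
theorem exists_of_mul_eq_of_evalSub {ι : Type*} [Fintype ι] (a : ι → centralizerQuot δ E) :
    ∃ z : Subring.center (DiffPoly δ), z ≠ 0 ∧ ∀ i, ∃ Q : E[X],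
      of (DiffPoly δ) z * a i = of (DiffPoly δ) (evalSub hx E Q) := by
  obtain ⟨z, hz, h⟩ := exists_common_denominator
    fun i => (a i : CentralQuotients (DiffPoly δ))
  refine ⟨z, hz, fun i => ?_⟩
  obtain ⟨r, hr⟩ := h i
  obtain ⟨Q, hQE, hQ⟩ := exists_eq_evalCenter_of_commute hx hN hlead hmin E hE r (by
    intro e he
    apply of_injective
    rw [map_mul, map_mul, ← hr, mul_assoc, ← mem_centralizerQuot.mp (a i).2 e he, ← mul_assoc,
      of_coe_commute, mul_assoc])
  have hlift : Q ∈ Polynomial.lifts (E.val : E →+* D) := by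
    rw [Polynomial.lifts_iff_coeff_lifts]
    exact fun q => ⟨⟨_, hQE q⟩, rfl⟩
  obtain ⟨Q', rfl⟩ := (Polynomial.mem_lifts Q).mp hlift
  exact ⟨Q', by rw [hr, hQ]; rfl⟩

include hx hN hlead hmin hE in
theorem isMulCommutative_centralizerQuot : IsMulCommutative (centralizerQuot δ E) := by
  refine ⟨⟨fun a b => Subtype.ext ?_⟩⟩
  obtain ⟨z, hz, h⟩ := exists_of_mul_eq_of_evalSub hx hN hlead hmin hE ![a, b]
  obtain ⟨Q, hQ⟩ := h 0
  obtain ⟨Q', hQ'⟩ := h 1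
  have hu := isUnit_of_coe hz
  have hmul : ∀ c c' : CentralQuotients (DiffPoly δ), of (DiffPoly δ) z *
      (of (DiffPoly δ) z * (c * c')) = (of (DiffPoly δ) z * c) * (of (DiffPoly δ) z * c') := by
    intro c c'
    rw [← mul_assoc _ c, ← mul_assoc _ (_ * c), of_coe_commute z (_ * c),
      mul_assoc (of (DiffPoly δ) z * c)]
  -- The denominator is cancelled twice, once for each factor of the product.
  apply hu.mul_left_cancel
  apply hu.mul_left_cancel
  change _ * (_ * ((a : CentralQuotients (DiffPoly δ)) * b)) =
    _ * (_ * ((b : CentralQuotients (DiffPoly δ)) * a))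
  rw [hmul, hmul]
  change (_ * (![a, b] 0 : CentralQuotients (DiffPoly δ))) * (_ * (![a, b] 1 : centralizerQuot δ E))
    = (_ * (![a, b] 1 : CentralQuotients (DiffPoly δ))) * (_ * (![a, b] 0 : centralizerQuot δ E))
  rw [hQ, hQ', ← map_mul, ← map_mul, ← map_mul, ← map_mul, mul_comm]

variable {d : ℕ} (v : Module.Basis (Fin d) E D)

include hx hN hlead hmin hE in
theorem linearIndependent_basisVec : LinearIndependent (centralizerQuot δ E)
    fun b => of (DiffPoly δ) (basisVec δ v N b) := by
  rw [Fintype.linearIndependent_iff]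
  intro a ha
  obtain ⟨z, hz, h⟩ := exists_of_mul_eq_of_evalSub hx hN hlead hmin hE a
  choose Q hQ using h
  have h1 : ∑ b, evalSub hx E (Q b) * basisVec δ v N b = 0 := by
    apply of_injective
    rw [map_zero, map_sum, ← mul_zero (of (DiffPoly δ) z), ← ha, Finset.mul_sum]
    refine Finset.sum_congr rfl fun b _ => ?_
    rw [map_mul, ← hQ, mul_assoc]
    rfl
  have h2 := coordinates_unique v hx hN hlead Q h1
  intro b
  have h3 := hQ b
  rw [h2, Pi.zero_apply, map_zero, map_zero, (isUnit_of_coe hz).mul_right_eq_zero] at h3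
  exact Subtype.ext h3

include hx hN hlead in
theorem span_basisVec : ⊤ ≤ Submodule.span (centralizerQuot δ E)
    (Set.range fun b => of (DiffPoly δ) (basisVec δ v N b)) := by
  intro a _
  obtain ⟨z, r, hz, hr⟩ := exists_of_mul_eq a
  obtain ⟨Q, hQ, -⟩ := exists_coordinates v hx hN hlead (h := r) ⟨le_rfl, rfl⟩
  have hz' : algebraMap (Subring.center (DiffPoly δ))
      (FractionRing (Subring.center (DiffPoly δ))) z ≠ 0 := by
    rwa [Ne, FaithfulSMul.algebraMap_eq_zero_iff]
  let w : centralizerQuot δ E := algebraMap (FractionRing (Subring.center (DiffPoly δ))) _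
    (algebraMap (Subring.center (DiffPoly δ)) (FractionRing (Subring.center (DiffPoly δ))) z)⁻¹
  have hw : (w : CentralQuotients (DiffPoly δ)) * of (DiffPoly δ) z = 1 := by
    rw [← algebraMap_algebraMap]
    change algebraMap _ _ _ * algebraMap _ _ _ = _
    rw [← map_mul, inv_mul_cancel₀ hz', map_one]
  have h1 : a = ∑ b, (w * evalQuot hx E (Q b)) • of (DiffPoly δ) (basisVec δ v N b) := by
    have h2 : a = w * of (DiffPoly δ) r := by rw [← hr, ← mul_assoc, hw, one_mul]
    rw [h2, hQ, map_sum, Finset.mul_sum]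
    refine Finset.sum_congr rfl fun b _ => ?_
    rw [map_mul, ← mul_assoc]
    rfl
  rw [h1]
  exact sum_mem fun b _ => Submodule.smul_mem _ _ (Submodule.subset_span ⟨b, rfl⟩)

end

/-- The generic-element argument behind `reducedNorm_spec` needs an infinite base field; powers of
`x` supply one even when `F` is finite. -/
theorem infinite_fractionRing (hx : x ∈ Subring.center (DiffPoly δ)) {N : ℕ} (hN : 0 < N)
    (hlead : HasLead x N 1) : Infinite (FractionRing (Subring.center (DiffPoly δ))) := by
  refine Infinite.of_injective (fun n : ℕ => algebraMap (Subring.center (DiffPoly δ))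
    (FractionRing (Subring.center (DiffPoly δ))) (⟨x, hx⟩ ^ n)) fun n k h => ?_
  have h1 := congrArg Subtype.val (FaithfulSMul.algebraMap_injective _ _ h)
  have h2 : evalCenter hx (X ^ n) = evalCenter hx (X ^ k) := by
    rw [map_pow, map_pow, evalCenter_X]
    exact h1
  have h3 := congrArg natDegree (evalCenter_injective hx hN hlead h2)
  simpa using h3

/-- `det_regMatrix_eq_reducedNorm` with `S` the centralizer of `E`, over which the elements `v_k
t^r` are a basis and `f` has matrix `M`. -/
theorem reducedNorm_eq_of_matrix (hx : x ∈ Subring.center (DiffPoly δ)) {N : ℕ} (hN : 0 < N)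
    (hlead : HasLead x N 1) (hmin : N ≤ (minpoly δ.centralConst δ.centerEnd).natDegree)
    (hR : ∀ f : DiffPoly δ, f ≠ 0 → ∃ y, y * f ∈ Subring.center (DiffPoly δ) ∧ y * f ≠ 0)
    {E : Subalgebra (Subring.center D) D} [IsMulCommutative E]
    (hE : ∀ z, (∀ e ∈ E, z * e = e * z) → z ∈ E) {d : ℕ} (v : Module.Basis (Fin d) E D)
    (f : DiffPoly δ) (M : Matrix (Fin d × Fin N) (Fin d × Fin N) E[X])
    (hM : ∀ i, basisVec δ v N i * f = ∑ b, evalSub hx E (M i b) * basisVec δ v N b) :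
    algebraMap (FractionRing (Subring.center (DiffPoly δ))) (CentralQuotients (DiffPoly δ))
      (reducedNorm (FractionRing (Subring.center (DiffPoly δ))) (CentralQuotients (DiffPoly δ))
        (of (DiffPoly δ) f)) = of (DiffPoly δ) (evalSub hx E M.det) := by
  have := infinite_fractionRing hx hN hlead
  have := isMulCommutative_centralizerQuot hx hN hlead hmin hE
  have hA := isUnit_of_ne_zero hR
  have : NoZeroDivisors (centralizerQuot δ E) := by
    refine ⟨fun {a b} hab => ?_⟩
    by_contra! hne
    have h1 : (a : CentralQuotients (DiffPoly δ)) ≠ 0 := fun h => hne.1 (Subtype.ext h)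
    have h2 : (a : CentralQuotients (DiffPoly δ)) * b = 0 := congrArg Subtype.val hab
    rw [(hA _ h1).mul_right_eq_zero] at h2
    exact hne.2 (Subtype.ext h2)
  have : IsDomain (centralizerQuot δ E) := NoZeroDivisors.to_isDomain _
  let b : Module.Basis (Fin d × Fin N) (centralizerQuot δ E) (CentralQuotients (DiffPoly δ)) :=
    Module.Basis.mk (linearIndependent_basisVec hx hN hlead hmin hE v)
      (span_basisVec hx hN hlead v)
  have hb : ∀ i, b i = of (DiffPoly δ) (basisVec δ v N i) := fun i => Module.Basis.mk_apply _ _ i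
  have h1 := det_regMatrix_eq_reducedNorm (K := FractionRing (Subring.center (DiffPoly δ))) hA
    (S := centralizerQuot δ E) (by
      intro a ha
      -- `S` contains `E` because `E` is commutative, so whatever commutes with `S` commutes with
      -- `E` and lies in `S`.
      have hmem : a ∈ centralizerQuot δ E := by
        rw [mem_centralizerQuot]
        intro e he
        have h2 := ha ⟨of (DiffPoly δ) (const δ e), by
          rw [mem_centralizerQuot]
          intro e' he'
          rw [← map_mul, ← map_mul, ← map_mul, ← map_mul]
          exact congrArg (fun y : E => of (DiffPoly δ) (const δ (y : D)))
            (mul_comm (⟨e', he'⟩ : E) ⟨e, he⟩)⟩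
        change (_ * 1) * a = a * (_ * 1) at h2
        rwa [mul_one] at h2
      exact ⟨⟨a, hmem⟩, mul_one a⟩) b (of (DiffPoly δ) f)
  have h2 : regMatrix b (of (DiffPoly δ) f) = (evalQuot hx E).mapMatrix M := by
    ext i j : 2
    rw [regMatrix_apply]
    have h3 : b i * of (DiffPoly δ) f = ∑ k, evalQuot hx E (M i k) • b k := by
      rw [hb, ← map_mul, hM, map_sum]
      refine Finset.sum_congr rfl fun k _ => ?_
      rw [hb, map_mul]
      rfl
    rw [h3, b.repr_sum_self]
    rfl
  rw [h2, ← RingHom.map_det] at h1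
  exact (congrArg Subtype.val h1).symm

end DiffPoly

/-! ### Assembly of the norm formula. -/

theorem natDegree_of_eq_pPolynomial {F : Type*} [Field F] {p : ℕ} (hp : p.Prime) (e : ℕ)
    (c : ℕ → F) {g : F[X]}
    (hg : g = X ^ p ^ e + ∑ i ∈ Finset.Icc 1 e, C (c i) * X ^ p ^ (e - i)) :
    g.natDegree = p ^ e := by
  have h : (∑ i ∈ Finset.Icc 1 e, C (c i) * X ^ p ^ (e - i)).degree < ((p ^ e : ℕ) : WithBot ℕ) := by
    rw [← Polynomial.mem_degreeLT]
    refine sum_mem fun i hi => ?_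
    rw [Polynomial.mem_degreeLT]
    refine (degree_C_mul_X_pow_le _ _).trans_lt ?_
    have := Finset.mem_Icc.mp hi
    exact_mod_cast Nat.pow_lt_pow_right hp.one_lt (by omega)
  rw [hg, natDegree_eq_of_degree_eq (degree_add_eq_left_of_degree_lt (by rwa [degree_X_pow])),
    natDegree_X_pow]

theorem mainTheorem12 {D : Type u} [DivisionRing D] (p : ℕ) (hp : p.Prime) [CharP D p]
    [Module.Finite (Subring.center D) D] (d : ℕ)
    (hd : Module.finrank (Subring.center D) D = d ^ 2)
    (δ : RingDerivation D) (e : ℕ) (c : ℕ → δ.centralConst) (g : δ.centralConst[X])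
    (hg : g = X ^ p ^ e + ∑ i ∈ Finset.Icc 1 e, C (c i) * X ^ p ^ (e - i))
    (hδ : IsAlgebraic δ.centralConst δ.centerEnd)
    (hgmin : minpoly δ.centralConst δ.centerEnd = g)
    (d₀ : D) (hd₀ : ∀ a : D, (aeval δ.toEnd g) a = d₀ * a - a * d₀) (hδd₀ : δ d₀ = 0)
    (E : Subalgebra (Subring.center D) D) [IsMulCommutative E] (hE : IsField E)
    (hEd : Module.finrank (Subring.center D) E = d)
    (v : Module.Basis (Fin d) E D)
    (f : DiffPoly δ) (m : ℕ) (hf : (DiffPoly.toPoly δ f).degree = m) :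
    ∃ P : δ.centralConst[X],
      algebraMap (FractionRing (Subring.center (DiffPoly δ))) (CentralQuotients (DiffPoly δ))
          (reducedNorm (FractionRing (Subring.center (DiffPoly δ)))
            (CentralQuotients (DiffPoly δ)) (CentralQuotients.of (DiffPoly δ) f)) =
        CentralQuotients.of (DiffPoly δ)
          (DiffPoly.evalAt δ (DiffPoly.centralVar δ g d₀) P) ∧
      (algebraMap δ.centralConst D (P.coeff (d * m)) =
          (((leftRegularRep v ((DiffPoly.toPoly δ f).coeff m)).det ^ p ^ e : E) : D) ∨
        algebraMap δ.centralConst D (P.coeff (d * m)) =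
          -(((leftRegularRep v ((DiffPoly.toPoly δ f).coeff m)).det ^ p ^ e : E) : D)) ∧
      P.degree = ((d * m : ℕ) : WithBot ℕ) := by
  have : Fact p.Prime := ⟨hp⟩
  have hdeg : g.natDegree = p ^ e := natDegree_of_eq_pPolynomial hp e c hg
  have hN : 0 < p ^ e := pow_pos hp.pos e
  have : NeZero (p ^ e) := ⟨hN.ne'⟩
  have hmonic : g.Monic := hgmin ▸ minpoly.monic hδ.isIntegral
  have hx := DiffPoly.centralVar_mem_center p e c g hg d₀ hd₀ hδd₀
  have hlead := DiffPoly.hasLead_centralVar hmonic (hdeg ▸ hN) d₀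
  rw [hdeg] at hlead
  have hmin : p ^ e ≤ (minpoly δ.centralConst δ.centerEnd).natDegree := by rw [hgmin, hdeg]
  have hEc := mem_of_forall_commute hd E hEd v
  have hflead : DiffPoly.HasLead f m ((DiffPoly.toPoly δ f).coeff m) :=
    ⟨(natDegree_eq_of_degree_eq_some hf).le, rfl⟩
  have ha : (DiffPoly.toPoly δ f).coeff m ≠ 0 := coeff_ne_zero_of_eq_degree hf
  obtain ⟨M, hM, hMc⟩ := DiffPoly.exists_matrix v hx hN hlead hflead
  obtain ⟨hMdeg, hMlead⟩ := det_coeff_of_weighted m _ M hMc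
  have hnorm := DiffPoly.reducedNorm_eq_of_matrix hx hN hlead hmin
    (DiffPoly.exists_mul_mem_center p v hx hN hlead) hEc v f M hM
  -- The determinant is a reduced norm, hence comes from `K` and is central; this brings its
  -- coefficients from `E` down to `F`.
  have hcen : DiffPoly.evalCenter hx (M.det.map (E.val : E →+* D)) ∈
      Subring.center (DiffPoly δ) := by
    rw [Subring.mem_center_iff]
    intro r
    apply CentralQuotients.of_injective
    rw [map_mul, map_mul, ← DiffPoly.evalSub_apply, ← hnorm]
    exact (Algebra.commutes _ _).symm
  obtain ⟨P, hP⟩ := DiffPoly.exists_map_eq_of_evalCenter_mem_center hx hN hlead _ hcen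
  have hcoeff : ∀ q, algebraMap δ.centralConst D (P.coeff q) = (M.det.coeff q : D) := by
    intro q
    rw [← coeff_map, hP, coeff_map]
    rfl
  have hlr : leftRegularRep v ((DiffPoly.toPoly δ f).coeff m) =
    regMatrix v ((DiffPoly.toPoly δ f).coeff m) := rfl
  refine ⟨P, ?_, ?_, ?_⟩
  · rw [hnorm, DiffPoly.evalAt_eq_evalCenter hx, hP]
    rfl
  · rw [hcoeff, hlr]
    rcases hMlead with h | h
    · left; rw [h]
    · right; rw [h]; rfl
  -- `a_m` is invertible in `D`, so its regular determinant is nonzero and the degree is exactly `d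
  -- * m`.
  · have hne : P.coeff (d * m) ≠ 0 := by
      intro h0
      have h1 := hcoeff (d * m)
      rw [h0, map_zero] at h1
      have h2 : M.det.coeff (d * m) = 0 := Subtype.ext h1.symm
      have h3 := pow_ne_zero (p ^ e) (DiffPoly.det_regMatrix_ne_zero v ha)
      rcases hMlead with h | h
      · exact h3 (h.symm.trans h2)
      · exact h3 (neg_eq_zero.mp (h.symm.trans h2))
    refine le_antisymm ?_ (le_degree_of_ne_zero hne)
    rw [degree_le_iff_coeff_zero]
    intro q hq
    apply (algebraMap δ.centralConst D).injective
    rw [hcoeff, map_zero, coeff_eq_zero_of_natDegree_lt (hMdeg.trans_lt (by exact_mod_cast hq))]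
    rfl
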